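/- **Setting.** A transmitter communicates at a fixed rate $R>0$ over a fast fading channel with noise power $\sigma_N^2>0$ in the presence of a jammer. The channel coefficient $h\ge 0$ has a probability density. The (large number of) frames are modelled by an atomless standard Borel probability space $(\Omega,\mu)$. Within a frame, the players use nonnegative measurable power allocations $P(h)$, $J(h)$, spend the powers $\mathbf E_h[P(h)]$, $\mathbf E_h[J(h)]$, and the ergodic capacity is $$C(P,J)=\mathbf E_h\Big[\log\Big(1+\frac{hP(h)}{\sigma_N^2+J(h)}\Big)\Big]\in[0,\infty].$$ A pure strategy of a player is a jointly measurable choice of an allocation for each frame $\omega\in\Omega$. The powers spent, averaged over all frames, are at most $\mathcal P>0$ for the transmitter and at most $\mathcal J>0$ for the jammer. The outage probability is $\mu\{\omega: C(P_\omega,J_\omega)<R\}$. In the minimax scenario the jammer knows the transmitter's strategy; so the transmitter minimizes the *worst-case outage*, that is, the supremum of the outage probability over all admissible jammer strategies. For $P_M\ge0$ let $$\mathscr J_M(P_M)=\sup_{P\ge 0,\ \mathbf E_h[P]\le P_M}\ \inf\{\mathbf E_h[J]:\ J\ge 0,\ C(P,J)\le R\}\in[0,\infty],$$ and call an allocation $P$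 with $\mathbf E_h[P]=P_M$ *optimal for $P_M$* if it attains this supremum. For $P_M\ge\mathcal P$ let $$P_{out}(P_M)=\min\Big\{1,\ 1-\frac{\mathcal P}{P_M}+\frac{\mathcal J}{\mathscr J_M(P_M)}\Big\}\qquad (\mathcal J/0=\infty,\ \mathcal J/\infty=0).$$ **Theorem.** 1. $P_{out}$ attains its minimum over $[\mathcal P,\infty)$. For every $P_M\ge\mathcal P$ there are an optimal allocation for $P_M$ and a measurable set of frames of measure $\mathcal P/P_M$. 2. Let $P_M>0$ and let $P$ be an optimal allocation for $P_M$. For measurable $S\subseteq\Omega$, the ON/OFF strategy that uses $P$ on the frames in $S$ and no power on the others satisfies the transmitter's constraint if and only if $\mu(S)\le\mathcal P/P_M$. Its worst-case outage is $1-\mu(S)+\min\{\mu(S),\mathcal J/\mathscr J_M(P_M)\}$, and it does not increase when $\mu(S)$ increases. 3. If $P_M\ge\mathcal P$, $P$ is optimal for $P_M$ and $\mu(S)=\mathcal P/P_M$ (transmission on as many frames as possible with the common power $P_M$), then the worst-case outage of the ON/OFF strategy is $P_{out}(P_M)$. If moreover $P_M$ minimizes $P_{out}$ over $[\mathcal P,\infty)$,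 then this strategy is optimal in the minimax scenario: no admissible transmitter strategy has a smaller worst-case outage. 4. The minimax value, i.e. the infimum of the worst-case outage over all admissible transmitter strategies, equals $$\inf_{P_M\ge\mathcal P}\Big(1-\frac{\mathcal P}{P_M}+\frac{\mathcal J}{\mathscr J_M(P_M)}\Big).$$ -/

import Mathlib

open MeasureTheory Set
open scoped ENNReal NNReal

noncomputable section

namespace Jamming

/-- A power allocation within one frame: the power used at each value `h` of the channel
coefficient (the squared modulus of the fading coefficient). -/
abbrev Allocation := ℝ → ℝ≥0

/-- The power `E_h[P(h)]` that the allocation `P` spends on a frame; `ν` is the law of `h`. -/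
def power (ν : Measure ℝ) (P : Allocation) : ℝ≥0∞ :=
  ∫⁻ h, (P h : ℝ≥0∞) ∂ν

/-- The ergodic capacity `C(P, J) = E_h[log (1 + h P(h) / (N + J(h)))]` with noise power `N`,
as an element of `[0, ∞]` (the integrand is nonnegative for `h ≥ 0`). -/
def capacity (ν : Measure ℝ) (N : ℝ) (P J : Allocation) : ℝ≥0∞ :=
  ∫⁻ h, ENNReal.ofReal (Real.log (1 + h * (P h : ℝ) / (N + (J h : ℝ)))) ∂ν

/-- The least jamming power that brings the capacity of a frame with transmitter allocation `P`
down to `R`: the inner minimum `min { E_h[J] : J ≥ 0, C(P, J) ≤ R }` (`∞` if no `J` does). -/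
def jamCost (ν : Measure ℝ) (N R : ℝ) (P : Allocation) : ℝ≥0∞ :=
  ⨅ (J : Allocation) (_ : Measurable J) (_ : capacity ν N P J ≤ ENNReal.ofReal R), power ν J

/-- The required jamming power `𝒥_M(P_M)`: the value of
`max { min { E_h[J] : J ≥ 0, C(P, J) ≤ R } : P ≥ 0, E_h[P] ≤ P_M }`. -/
def requiredJam (ν : Measure ℝ) (N R : ℝ) (PM : ℝ≥0) : ℝ≥0∞ :=
  ⨆ (P : Allocation) (_ : Measurable P) (_ : power ν P ≤ PM), jamCost ν N R P

/-- `P` is an optimal way of distributing the power `P_M` within a frame. -/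
structure IsOptimalAllocation (ν : Measure ℝ) (N R : ℝ) (PM : ℝ≥0) (P : Allocation) : Prop where
  measurable : Measurable P
  power_eq : power ν P = PM
  jamCost_eq : jamCost ν N R P = requiredJam ν N R PM

variable {Ω : Type*} [MeasurableSpace Ω]

/-- A pure strategy `T` of a player (a jointly measurable choice of an allocation for each frame
`ω`) that meets the average power constraint `E[power] ≤ B` over all frames. -/
structure Feasible (μ : Measure Ω) (ν : Measure ℝ) (B : ℝ≥0) (T : Ω → Allocation) : Prop where
  measurable : Measurable (Function.uncurry T)
  avg_le : ∫⁻ ω, power ν (T ω) ∂μ ≤ B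

/-- The probability of outage: the fraction of frames whose capacity is below `R`. -/
def outage (μ : Measure Ω) (ν : Measure ℝ) (N R : ℝ) (T U : Ω → Allocation) : ℝ≥0∞ :=
  μ {ω | capacity ν N (T ω) (U ω) < ENNReal.ofReal R}

/-- The outage probability of the transmitter strategy `T` against a jammer who knows `T`
and has average power `B`. -/
def worstOutage (μ : Measure Ω) (ν : Measure ℝ) (N R : ℝ) (B : ℝ≥0) (T : Ω → Allocation) :
    ℝ≥0∞ :=
  ⨆ (U : Ω → Allocation) (_ : Feasible μ ν B U), outage μ ν N R T U

/-- `T` is an optimal transmitter strategy in the minimax scenario with power budgets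
`A` (transmitter) and `B` (jammer). -/
def IsMinimaxOptimal (μ : Measure Ω) (ν : Measure ℝ) (N R : ℝ) (A B : ℝ≥0)
    (T : Ω → Allocation) : Prop :=
  Feasible μ ν A T ∧
    ∀ T' : Ω → Allocation, Feasible μ ν A T' →
      worstOutage μ ν N R B T ≤ worstOutage μ ν N R B T'

open Classical in
/-- The ON/OFF strategy that uses the allocation `P` on every frame of `S` and is silent on the
other frames. -/
def onOff (S : Set Ω) (P : Allocation) : Ω → Allocation :=
  fun ω => if ω ∈ S then P else 0

/-- The expression `1 - 𝒫 / P_M + 𝒥 / 𝒥_M(P_M)` (used for `𝒫 ≤ P_M`); the values are in `[0, ∞]`,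
with `𝒥 / 0 = ∞` for `𝒥 > 0` and `𝒥 / ∞ = 0`. -/
def outageFormula (ν : Measure ℝ) (N R : ℝ) (A B : ℝ≥0) (PM : ℝ≥0) : ℝ≥0∞ :=
  1 - (A : ℝ≥0∞) / PM + (B : ℝ≥0∞) / requiredJam ν N R PM

/-- The outage probability as a function of `P_M`: the preceding expression, capped at one. -/
def pOut (ν : Measure ℝ) (N R : ℝ) (A B : ℝ≥0) (PM : ℝ≥0) : ℝ≥0∞ :=
  min 1 (outageFormula ν N R A B PM)

end Jamming

end

/-!
Write `V q` for the required jamming power at the transmitter power `q`. The theorem rests on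
three properties of the jamming cost of a single frame.

* *Scaling.* Multiplying both powers by `c ≥ 1` can only increase the capacity, because the noise
  is left unchanged. Hence `c V(q) ≤ V(c q)`, that is, `V(q) / q` is nondecreasing
  (`mul_requiredJam_le`, `requiredJam_mul_le`).
* *Compactness.* The capacity is concave in the transmitter power, so allocations with jamming cost
  at least `v` form a convex family. Approximate minimizers of a strictly convex functional over a
  decreasing sequence of such families converge almost everywhere along a subsequence
  (`exists_ae_tendsto_of_midpoint_convex`), and the capacity is upper semicontinuous along this
  subsequence when `log (1 + h)` is integrable (`le_capacity_of_tendsto`). Thus optimal allocations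
  exist and `V` is right continuous (`exists_le_jamCost_of_forall_gt`). When `log (1 + h)` is not
  integrable, `V` is infinite at every positive power and constant allocations are optimal
  (`jamCost_const_eq_top`).
* *Selection.* The capacity is Lipschitz in the jamming allocation with respect to the mean, so the
  jammer can choose nearly cheapest allocations from a countable dense family, measurably in the
  frame (`exists_feasible_capacity_lt`).

For ON/OFF strategies the worst-case outage follows from selection and from the divisibility of
atomless measures (`worstOutage_onOff`). For an arbitrary strategy, suppose that `m` is smaller than
`pOut` at every common power level. The jammer attacks the fraction `m` of the frames that carry the
least power, say power at most `t`. If `t ≥ 𝒫`, scaling bounds the cost of a frame of power `x` by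
`x V(t) / t`, the remaining frames use at least `(1 - m) t`, and the total cost is at most
`V(t) (𝒫 / t - (1 - m))`, which is below `𝒥` because `m < 1 - 𝒫 / t + 𝒥 / V(t)`. If `t < 𝒫`, the
cost is at most `m V(𝒫)`, again below `𝒥`. So the outage `m` is reached
(`iInf_pOut_le_worstOutage`). Right continuity of `V` makes `pOut` lower semicontinuous, which gives
a minimizer (`exists_isMinOn_pOut`). Finally `V` is unbounded because the channel is almost surely
nonzero, so capping the formula at one does not change its infimum (`iInf_outageFormula_le_one`).
-/

namespace Jamming

open Filter Topology

section

/-! ### The rate at a fixed channel state -/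

/-- The rate `log (1 + h p / (N + j))` achieved at the channel state `h` with transmitter power `p`
against jamming power `j`; the capacity is its mean over `h`. -/
noncomputable def rate (N h : ℝ) (p j : ℝ≥0) : ℝ≥0∞ :=
  ENNReal.ofReal (Real.log (1 + h * (p : ℝ) / (N + (j : ℝ))))

theorem capacity_eq_lintegral_rate (ν : Measure ℝ) (N : ℝ) (P J : Allocation) :
    capacity ν N P J = ∫⁻ h, rate N h (P h) (J h) ∂ν := rfl

theorem measurable_rate (N : ℝ) :
    Measurable fun x : ℝ × ℝ≥0 × ℝ≥0 => rate N x.1 x.2.1 x.2.2 := by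
  unfold rate
  fun_prop

theorem measurable_rate_comp {α : Type*} [MeasurableSpace α] (N : ℝ) {h : α → ℝ} {p j : α → ℝ≥0}
    (hh : Measurable h) (hp : Measurable p) (hj : Measurable j) :
    Measurable fun a => rate N (h a) (p a) (j a) :=
  (measurable_rate N).comp (hh.prodMk (hp.prodMk hj))

variable {N h : ℝ}

theorem rate_mono_left (hN : 0 < N) (hh : 0 ≤ h) {p p' : ℝ≥0} (hp : p ≤ p') (j : ℝ≥0) :
    rate N h p j ≤ rate N h p' j := by
  have hj : 0 < N + (j : ℝ) := by positivity
  have hp' : (p : ℝ) ≤ p' := hp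
  unfold rate
  gcongr

theorem rate_anti_right (hN : 0 < N) (hh : 0 ≤ h) (p : ℝ≥0) {j j' : ℝ≥0} (hj : j ≤ j') :
    rate N h p j' ≤ rate N h p j := by
  have hj0 : 0 < N + (j : ℝ) := by positivity
  have hj' : (j : ℝ) ≤ j' := hj
  unfold rate
  gcongr

/-- The rate is Lipschitz in the jamming power: raising it from `j` to `j'` costs the transmitter
at most `(j' - j) / N`. -/
theorem rate_le_rate_add (hN : 0 < N) (hh : 0 ≤ h) (p j j' : ℝ≥0) :
    rate N h p j ≤ rate N h p j' + ENNReal.ofReal (1 / N) * ((j' - j : ℝ≥0) : ℝ≥0∞) := by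
  rcases le_total j' j with hjj | hjj
  · exact (rate_anti_right hN hh p hjj).trans le_self_add
  · have hj : 0 < N + (j : ℝ) := by positivity
    have hj' : 0 < N + (j' : ℝ) := by positivity
    have hjr : (j : ℝ) ≤ j' := hjj
    have ha : 0 ≤ h * (p : ℝ) := by positivity
    have hd : 0 ≤ (j' : ℝ) - j := sub_nonneg.2 hjr
    have e : ((j' - j : ℝ≥0) : ℝ≥0∞) = ENNReal.ofReal ((j' : ℝ) - j) := by
      rw [← NNReal.coe_sub hjj, ENNReal.ofReal_coe_nnreal]
    unfold rate
    rw [e, ← ENNReal.ofReal_mul (by positivity), ← ENNReal.ofReal_add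
      (Real.log_nonneg (by have : 0 ≤ h * (p : ℝ) / (N + j') := by positivity
                           linarith)) (by positivity)]
    apply ENNReal.ofReal_le_ofReal
    have h1 : 1 + h * (p : ℝ) / (N + j) ≤
        (1 + h * (p : ℝ) / (N + j')) * (1 + 1 / N * ((j' : ℝ) - j)) := by
      have h2 : 1 + h * (p : ℝ) / (N + j) ≤
          (1 + h * (p : ℝ) / (N + j')) * (1 + 1 / (N + j) * ((j' : ℝ) - j)) := by
        have : (1 + h * (p : ℝ) / (N + j')) * (1 + 1 / (N + j) * ((j' : ℝ) - j)) -
            (1 + h * (p : ℝ) / (N + j)) = ((j' : ℝ) - j) / (N + j) := by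
          field_simp
          ring
        have : 0 ≤ ((j' : ℝ) - j) / (N + j) := by positivity
        linarith
      refine h2.trans ?_
      gcongr
      simp
    have h3 : 0 < 1 + h * (p : ℝ) / (N + j) := by positivity
    have h4 : 0 < 1 + h * (p : ℝ) / (N + j') := by positivity
    have h5 : 0 < 1 + 1 / N * ((j' : ℝ) - j) := by positivity
    calc Real.log (1 + h * (p : ℝ) / (N + j)) ≤
        Real.log ((1 + h * (p : ℝ) / (N + j')) * (1 + 1 / N * ((j' : ℝ) - j))) :=
          Real.log_le_log h3 h1
      _ = Real.log (1 + h * (p : ℝ) / (N + j')) + Real.log (1 + 1 / N * ((j' : ℝ) - j)) :=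
          Real.log_mul h4.ne' h5.ne'
      _ ≤ _ := by
          gcongr
          have := Real.log_le_sub_one_of_pos h5
          linarith

/-- Midpoint concavity of the rate in the transmitter power. -/
theorem rate_add_rate_le (hN : 0 < N) (hh : 0 ≤ h) (p p' j : ℝ≥0) :
    rate N h p j + rate N h p' j ≤ 2 * rate N h ((p + p') / 2) j := by
  have hj : 0 < N + (j : ℝ) := by positivity
  unfold rate
  have hx : 0 ≤ h * (p : ℝ) / (N + j) := by positivity
  have hy : 0 ≤ h * (p' : ℝ) / (N + j) := by positivity
  set x := h * (p : ℝ) / (N + j) with hxd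
  set y := h * (p' : ℝ) / (N + j) with hyd
  have e : h * (((p + p') / 2 : ℝ≥0) : ℝ) / (N + j) = (x + y) / 2 := by
    rw [hxd, hyd]; push_cast; ring
  rw [e, ← ENNReal.ofReal_add (Real.log_nonneg (by linarith)) (Real.log_nonneg (by linarith)),
    ← Real.log_mul (by positivity) (by positivity)]
  have e2 : (2 : ℝ≥0∞) = ENNReal.ofReal 2 := by simp
  rw [e2, ← ENNReal.ofReal_mul (by norm_num)]
  apply ENNReal.ofReal_le_ofReal
  have : (2 : ℝ) * Real.log (1 + (x + y) / 2) = Real.log ((1 + (x + y) / 2) ^ 2) := by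
    rw [Real.log_pow]; norm_num
  rw [this]
  apply Real.log_le_log (by positivity)
  nlinarith [sq_nonneg (x - y)]

theorem rate_lt_rate (hN : 0 < N) (hh : 0 ≤ h) {p j d : ℝ≥0} (hd : 0 < d)
    (h0 : rate N h p j ≠ 0) : rate N h p (j + d) < rate N h p j := by
  have hj : 0 < N + (j : ℝ) := by positivity
  have hd' : (0 : ℝ) < d := hd
  unfold rate at *
  have hlog : 0 < Real.log (1 + h * (p : ℝ) / (N + j)) := by
    by_contra hc
    exact h0 (ENNReal.ofReal_of_nonpos (not_lt.1 hc))
  rw [ENNReal.ofReal_lt_ofReal_iff hlog]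
  by_cases hs : 0 < h * (p : ℝ)
  · apply Real.log_lt_log
    · have : 0 ≤ h * (p : ℝ) / (N + (j + d : ℝ≥0)) := by positivity
      linarith
    · have : h * (p : ℝ) / (N + (j + d : ℝ≥0)) < h * (p : ℝ) / (N + j) := by
        apply div_lt_div_of_pos_left hs hj
        push_cast; linarith
      linarith
  · have hs0 : h * (p : ℝ) = 0 := le_antisymm (not_lt.1 hs) (by positivity)
    simp [hs0] at hlog

/-- Multiplying both powers by a factor `c ≥ 1` increases the rate, since the noise is not
multiplied. -/
theorem rate_le_rate_mul (hN : 0 < N) (hh : 0 ≤ h) {c : ℝ≥0} (hc : 1 ≤ c) (p j : ℝ≥0) :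
    rate N h p (c⁻¹ * j) ≤ rate N h (c * p) j := by
  have hc' : (1 : ℝ) ≤ c := hc
  have hc0 : (0 : ℝ) < c := by linarith
  unfold rate
  have hj : 0 < N + ((c⁻¹ * j : ℝ≥0) : ℝ) := by positivity
  have hj' : 0 < N + (j : ℝ) := by positivity
  apply ENNReal.ofReal_le_ofReal
  apply Real.log_le_log (by positivity)
  gcongr 1 + ?_
  rw [div_le_div_iff₀ hj hj']
  push_cast
  have : h * (c * (p : ℝ)) * (N + (c : ℝ)⁻¹ * j) - h * p * (N + j) = h * p * N * (c - 1) := by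
    field_simp; ring
  have : 0 ≤ h * p * N * ((c : ℝ) - 1) := by
    have := sub_nonneg.2 hc'
    positivity
  linarith

/-- Sublinear growth of the rate in the transmitter power, uniformly up to the integrable term
`log (1 + h)`: the slope `k⁻¹` can be made as small as desired. -/
theorem rate_le_log_add (hN : 0 < N) (hh : 0 ≤ h) {k : ℝ} (hk : 1 ≤ k) (p j : ℝ≥0) :
    rate N h p j ≤ (ENNReal.ofReal (Real.log (1 + h)) +
      ENNReal.ofReal (Real.log (1 + 1 / N) + Real.log k)) + ENNReal.ofReal k⁻¹ * (p : ℝ≥0∞) := by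
  refine (rate_anti_right hN hh p (zero_le : 0 ≤ j)).trans ?_
  have hk0 : 0 < k := by linarith
  have l1 : 0 ≤ Real.log (1 + h) := Real.log_nonneg (by linarith)
  have l2 : 0 ≤ Real.log (1 + 1 / N) :=
    Real.log_nonneg (by have : 0 < 1 / N := by positivity
                        linarith)
  have l3 : 0 ≤ Real.log k := Real.log_nonneg hk
  have e : (p : ℝ≥0∞) = ENNReal.ofReal (p : ℝ) := (ENNReal.ofReal_coe_nnreal).symm
  unfold rate
  rw [e, ← ENNReal.ofReal_mul (by positivity), ← ENNReal.ofReal_add l1 (by positivity),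
    ← ENNReal.ofReal_add (by positivity) (by positivity)]
  apply ENNReal.ofReal_le_ofReal
  have hp : (0 : ℝ) ≤ p := p.2
  have h1 : 1 + h * (p : ℝ) / (N + ((0 : ℝ≥0) : ℝ)) ≤
      (1 + h) * ((1 + 1 / N) * (k * ((1 + p) / k))) := by
    have : k * ((1 + (p : ℝ)) / k) = 1 + p := by field_simp
    rw [this]
    have : (1 + h) * ((1 + 1 / N) * (1 + (p : ℝ))) - (1 + h * (p : ℝ) / (N + ((0 : ℝ≥0) : ℝ))) =
      h + h * p + p + 1 / N + h / N + p / N := by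
      push_cast; field_simp; ring
    have : 0 ≤ h + h * p + p + 1 / N + h / N + p / N := by positivity
    linarith
  have h2 := Real.log_le_sub_one_of_pos (x := (1 + (p : ℝ)) / k) (by positivity)
  have h3 : (1 + (p : ℝ)) / k - 1 ≤ k⁻¹ * p := by
    have : (1 + (p : ℝ)) / k = 1 / k + k⁻¹ * p := by field_simp
    have : 1 / k ≤ 1 := by rw [div_le_one hk0]; exact hk
    linarith
  calc Real.log (1 + h * (p : ℝ) / (N + ((0 : ℝ≥0) : ℝ))) ≤ Real.log _ :=
        Real.log_le_log (by positivity) h1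
    _ = Real.log (1 + h) + (Real.log (1 + 1 / N) + (Real.log k + Real.log ((1 + p) / k))) := by
        rw [Real.log_mul, Real.log_mul, Real.log_mul] <;> positivity
    _ ≤ _ := by linarith

theorem ofReal_log_le_rate_add (hN : 0 < N) (hh : 0 ≤ h) {q : ℝ≥0} (hq : 0 < q) :
    ENNReal.ofReal (Real.log (1 + h)) ≤
      rate N h q 0 + ENNReal.ofReal (Real.log (1 + N / q)) := by
  have hq' : (0 : ℝ) < q := hq
  unfold rate
  rw [← ENNReal.ofReal_add (Real.log_nonneg _) (Real.log_nonneg _), ← Real.log_mul]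
  · apply ENNReal.ofReal_le_ofReal
    apply Real.log_le_log (by positivity)
    have : (1 + h * (q : ℝ) / (N + ((0 : ℝ≥0) : ℝ))) * (1 + N / q) =
      1 + h + N / q + h * (q : ℝ) / N := by
      push_cast; field_simp; ring
    rw [this]
    have : 0 ≤ N / q + h * (q : ℝ) / N := by positivity
    linarith
  · positivity
  · positivity
  · have : 0 ≤ h * (q : ℝ) / (N + ((0 : ℝ≥0) : ℝ)) := by positivity
    linarith
  · have : 0 ≤ N / (q : ℝ) := by positivity
    linarith

end

section

/-! ### Capacity and jamming cost of a single frame -/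

variable {ν : Measure ℝ} {N R : ℝ}

theorem power_zero : power ν 0 = 0 := by simp [power]

theorem power_const [IsProbabilityMeasure ν] (q : ℝ≥0) : power ν (fun _ => q) = q := by
  simp [power]

theorem power_add_const [IsProbabilityMeasure ν] (P : Allocation) (q : ℝ≥0) :
    power ν (fun x => P x + q) = power ν P + q := by
  simp [power, lintegral_add_right _ measurable_const]

theorem power_add {P : Allocation} (hP : Measurable P) (P' : Allocation) :
    power ν (fun x => P x + P' x) = power ν P + power ν P' := by
  simp only [power, ENNReal.coe_add]
  exact lintegral_add_left hP.coe_nnreal_ennreal _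

theorem power_mul {P : Allocation} (hP : Measurable P) (c : ℝ≥0) :
    power ν (fun x => c * P x) = c * power ν P := by
  simp only [power, ENNReal.coe_mul]
  exact lintegral_const_mul _ hP.coe_nnreal_ennreal

theorem capacity_zero_left (J : Allocation) : capacity ν N 0 J = 0 := by
  simp [capacity]

theorem capacity_mono_left (hν : ∀ᵐ h ∂ν, 0 ≤ h) (hN : 0 < N) {P P' : Allocation}
    (h : P ≤ P') (J : Allocation) : capacity ν N P J ≤ capacity ν N P' J :=
  lintegral_mono_ae (hν.mono fun x hx => rate_mono_left hN hx (h x) (J x))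

theorem capacity_le_capacity_add (hν : ∀ᵐ h ∂ν, 0 ≤ h) (hN : 0 < N) (P : Allocation)
    {J J' : Allocation} (hJ : Measurable J) (hJ' : Measurable J') :
    capacity ν N P J ≤ capacity ν N P J' +
      ENNReal.ofReal (1 / N) * power ν (fun x => J' x - J x) := by
  have hm : Measurable fun x => ((J' x - J x : ℝ≥0) : ℝ≥0∞) := (hJ'.sub hJ).coe_nnreal_ennreal
  rw [capacity_eq_lintegral_rate, capacity_eq_lintegral_rate, power, ← lintegral_const_mul _ hm,
    ← lintegral_add_right _ (hm.const_mul _)]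
  exact lintegral_mono_ae (hν.mono fun x hx => rate_le_rate_add hN hx (P x) (J x) (J' x))

theorem capacity_add_capacity_le (hν : ∀ᵐ h ∂ν, 0 ≤ h) (hN : 0 < N) {P P' J : Allocation}
    (hP : Measurable P) (hP' : Measurable P') (hJ : Measurable J) :
    capacity ν N P J + capacity ν N P' J ≤ 2 * capacity ν N (fun x => (P x + P' x) / 2) J := by
  have h1 : Measurable fun x => rate N x (P x) (J x) :=
    measurable_rate_comp N measurable_id hP hJ
  have h2 : Measurable fun x => rate N x ((P x + P' x) / 2) (J x) :=
    measurable_rate_comp N measurable_id ((hP.add hP').div_const 2) hJ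
  simp only [capacity_eq_lintegral_rate]
  rw [← lintegral_add_left h1, ← lintegral_const_mul _ h2]
  exact lintegral_mono_ae (hν.mono fun x hx => rate_add_rate_le hN hx (P x) (P' x) (J x))

theorem capacity_add_const_lt (hν : ∀ᵐ h ∂ν, 0 ≤ h) (hN : 0 < N) (hR : 0 < R)
    {P J : Allocation} (hP : Measurable P) (hJ : Measurable J)
    (hC : capacity ν N P J ≤ ENNReal.ofReal R) {d : ℝ≥0} (hd : 0 < d) :
    capacity ν N P (fun x => J x + d) < ENNReal.ofReal R := by
  have hle : ∀ᵐ x ∂ν, rate N x (P x) (J x + d) ≤ rate N x (P x) (J x) :=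
    hν.mono fun x hx => rate_anti_right hN hx (P x) le_self_add
  rcases hC.lt_or_eq with hC | hC
  · exact (lintegral_mono_ae hle).trans_lt hC
  have hm : Measurable fun x => rate N x (P x) (J x) := measurable_rate_comp N measurable_id hP hJ
  rw [← hC]
  have hsupp : ν {x | rate N x (P x) (J x) ≠ 0} ≠ 0 := by
    intro h0
    have : capacity ν N P J = 0 := (lintegral_eq_zero_iff hm).2 h0
    rw [this] at hC
    exact (ENNReal.ofReal_pos.2 hR).ne hC
  refine lintegral_strict_mono_of_ae_le_of_ae_lt_on hm.aemeasurable ?_ hle hsupp ?_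
  · exact ((lintegral_mono_ae hle).trans_lt (by
      change capacity ν N P J < ∞
      rw [hC]; exact ENNReal.ofReal_lt_top)).ne
  · exact hν.mono fun x hx h0 => rate_lt_rate hN hx hd h0

theorem le_jamCost_iff {P : Allocation} {v : ℝ≥0∞} :
    v ≤ jamCost ν N R P ↔ ∀ J : Allocation, Measurable J →
      capacity ν N P J ≤ ENNReal.ofReal R → v ≤ power ν J := by
  simp only [jamCost, le_iInf_iff]

theorem jamCost_lt_iff {P : Allocation} {v : ℝ≥0∞} :
    jamCost ν N R P < v ↔ ∃ J : Allocation, Measurable J ∧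
      capacity ν N P J ≤ ENNReal.ofReal R ∧ power ν J < v := by
  simp only [jamCost, iInf_lt_iff, exists_prop]

theorem jamCost_le {P J : Allocation} (hJ : Measurable J)
    (hC : capacity ν N P J ≤ ENNReal.ofReal R) : jamCost ν N R P ≤ power ν J :=
  le_jamCost_iff.1 le_rfl J hJ hC

/-- The jammer can push the capacity strictly below `R` at any cost exceeding `jamCost`: a little
extra power on every channel state makes the inequality strict. -/
theorem exists_capacity_lt [IsProbabilityMeasure ν] (hν : ∀ᵐ h ∂ν, 0 ≤ h) (hN : 0 < N)
    (hR : 0 < R) {P : Allocation} (hP : Measurable P) {c : ℝ≥0∞} (hc : jamCost ν N R P < c) :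
    ∃ J : Allocation, Measurable J ∧ capacity ν N P J < ENNReal.ofReal R ∧ power ν J < c := by
  obtain ⟨J, hJ, hC, hJc⟩ := jamCost_lt_iff.1 hc
  obtain ⟨d, hd, hdc⟩ := ENNReal.lt_iff_exists_add_pos_lt.1 hJc
  exact ⟨fun x => J x + d, hJ.add_const _, capacity_add_const_lt hν hN hR hP hJ hC hd,
    by rwa [power_add_const]⟩

theorem jamCost_mono (hν : ∀ᵐ h ∂ν, 0 ≤ h) (hN : 0 < N) {P P' : Allocation} (h : P ≤ P') :
    jamCost ν N R P ≤ jamCost ν N R P' :=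
  le_jamCost_iff.2 fun J hJ hC => jamCost_le hJ ((capacity_mono_left hν hN h J).trans hC)

/-- Scaling the transmitter power by `c ≥ 1` scales the jamming cost by at least `c`. -/
theorem mul_jamCost_le (hν : ∀ᵐ h ∂ν, 0 ≤ h) (hN : 0 < N) (P : Allocation) {c : ℝ≥0}
    (hc : 1 ≤ c) : c * jamCost ν N R P ≤ jamCost ν N R (fun x => c * P x) := by
  refine le_jamCost_iff.2 fun J hJ hC => ?_
  have hc0 : c ≠ 0 := (zero_lt_one.trans_le hc).ne'
  have h1 : capacity ν N P (fun x => c⁻¹ * J x) ≤ ENNReal.ofReal R :=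
    (lintegral_mono_ae (hν.mono fun x hx => rate_le_rate_mul hN hx hc (P x) (J x))).trans hC
  have h2 := jamCost_le (hJ.const_mul c⁻¹) h1
  rw [power_mul hJ] at h2
  calc c * jamCost ν N R P ≤ c * (((c⁻¹ : ℝ≥0) : ℝ≥0∞) * power ν J) := by gcongr
    _ = power ν J := by
      rw [← mul_assoc, ← ENNReal.coe_mul, mul_inv_cancel₀ hc0, ENNReal.coe_one, one_mul]

/-- A quantitative lower bound on the cost of jamming, from the Lipschitz continuity of the
capacity. -/
theorem capacity_le_add_jamCost (hν : ∀ᵐ h ∂ν, 0 ≤ h) (hN : 0 < N) (P : Allocation) :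
    capacity ν N P 0 ≤ ENNReal.ofReal R + ENNReal.ofReal (1 / N) * jamCost ν N R P := by
  have key : ∀ J : Allocation, Measurable J → capacity ν N P J ≤ ENNReal.ofReal R →
      capacity ν N P 0 ≤ ENNReal.ofReal R + ENNReal.ofReal (1 / N) * power ν J := by
    intro J hJ hC
    have h := capacity_le_capacity_add hν hN P (J := 0) measurable_const hJ
    simp only [Pi.zero_apply, tsub_zero] at h
    exact h.trans (by gcongr)
  refine ENNReal.le_of_forall_pos_le_add fun ε hε _ => ?_
  by_cases hj : jamCost ν N R P = ∞
  · have : ENNReal.ofReal (1 / N) ≠ 0 := by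
      rw [Ne, ENNReal.ofReal_eq_zero, not_le]; positivity
    rw [hj, ENNReal.mul_top this]
    simp
  have hN' : 0 < Real.toNNReal N := Real.toNNReal_pos.2 hN
  obtain ⟨J, hJ, hC, hlt⟩ := jamCost_lt_iff.1 (ENNReal.lt_add_right hj
    (ENNReal.coe_ne_zero.2 (mul_pos hN' hε).ne'))
  refine (key J hJ hC).trans ?_
  rw [add_assoc]
  gcongr
  calc ENNReal.ofReal (1 / N) * power ν J
      ≤ ENNReal.ofReal (1 / N) * (jamCost ν N R P + ((N.toNNReal * ε : ℝ≥0) : ℝ≥0∞)) := by gcongr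
    _ = _ := by
      rw [mul_add]
      congr 1
      rw [ENNReal.ofReal, ← ENNReal.coe_mul, ← mul_assoc, ← Real.toNNReal_mul (by positivity)]
      have : 1 / N * N = 1 := by field_simp
      rw [this, Real.toNNReal_one, one_mul]

/-! ### The required jamming power as a function of the transmitter power -/

theorem jamCost_le_requiredJam {P : Allocation} (hP : Measurable P) {q : ℝ≥0}
    (hq : power ν P ≤ q) : jamCost ν N R P ≤ requiredJam ν N R q :=
  le_iSup_of_le P (le_iSup₂_of_le hP hq le_rfl)

theorem lt_requiredJam_iff {q : ℝ≥0} {v : ℝ≥0∞} :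
    v < requiredJam ν N R q ↔ ∃ P : Allocation, Measurable P ∧ power ν P ≤ q ∧
      v < jamCost ν N R P := by
  simp only [requiredJam, lt_iSup_iff, exists_prop]

theorem requiredJam_le_iff {q : ℝ≥0} {v : ℝ≥0∞} :
    requiredJam ν N R q ≤ v ↔ ∀ P : Allocation, Measurable P → power ν P ≤ q →
      jamCost ν N R P ≤ v := by
  simp only [requiredJam, iSup_le_iff]

theorem requiredJam_mono : Monotone (requiredJam ν N R) := fun _ _ h =>
  requiredJam_le_iff.2 fun _ hP hq =>
    jamCost_le_requiredJam hP (hq.trans (ENNReal.coe_le_coe.2 h))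

/-- The required jamming power grows at least linearly along rays: `V (c q) ≥ c V q` for
`c ≥ 1`. -/
theorem mul_requiredJam_le (hν : ∀ᵐ h ∂ν, 0 ≤ h) (hN : 0 < N) (q : ℝ≥0) {c : ℝ≥0}
    (hc : 1 ≤ c) : c * requiredJam ν N R q ≤ requiredJam ν N R (c * q) := by
  simp only [requiredJam, ENNReal.mul_iSup]
  refine iSup_le fun P => iSup₂_le fun hP hq => (mul_jamCost_le hν hN P hc).trans ?_
  refine jamCost_le_requiredJam (hP.const_mul c) ?_
  rw [power_mul hP, ENNReal.coe_mul]
  gcongr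

/-- The ratio `V x / x` is nondecreasing, in product form. -/
theorem requiredJam_mul_le (hν : ∀ᵐ h ∂ν, 0 ≤ h) (hN : 0 < N) {x t : ℝ≥0} (hxt : x ≤ t) :
    requiredJam ν N R x * t ≤ requiredJam ν N R t * x := by
  rcases eq_or_ne x 0 with rfl | hx
  · have : requiredJam ν N R 0 = 0 := by
      refine le_antisymm (requiredJam_le_iff.2 fun P hP hq => ?_) zero_le
      have h0 : (fun x => (P x : ℝ≥0∞)) =ᵐ[ν] 0 :=
        (lintegral_eq_zero_iff hP.coe_nnreal_ennreal).1 (by simpa [power] using hq)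
      have hC : capacity ν N P 0 = 0 := by
        rw [← capacity_zero_left (ν := ν) (N := N) 0]
        refine lintegral_congr_ae (h0.mono fun x hx => ?_)
        have hx' : P x = 0 := by simpa using hx
        simp [hx']
      exact (jamCost_le measurable_const (hC.trans_le zero_le)).trans_eq power_zero
    simp [this]
  have hc : 1 ≤ t / x := by rwa [one_le_div₀ (pos_iff_ne_zero.2 hx)]
  have h := mul_requiredJam_le (R := R) hν hN x hc
  rw [div_mul_cancel₀ _ hx] at h
  calc requiredJam ν N R x * t = ((t / x : ℝ≥0) : ℝ≥0∞) * requiredJam ν N R x * x := by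
        rw [mul_comm _ (x : ℝ≥0∞), ← mul_assoc, ← ENNReal.coe_mul, mul_div_cancel₀ _ hx, mul_comm]
    _ ≤ _ := by gcongr

/-- Since the channel is almost surely nonzero, transmitting with a large constant power makes
jamming arbitrarily expensive. -/
theorem exists_le_requiredJam [IsProbabilityMeasure ν] (hν : ∀ᵐ h ∂ν, 0 < h) (hN : 0 < N)
    (M : ℝ≥0) : ∃ q₀ : ℝ≥0, ∀ q, q₀ ≤ q → (M : ℝ≥0∞) ≤ requiredJam ν N R q := by
  have hν' : ∀ᵐ h ∂ν, 0 ≤ h := hν.mono fun _ h => h.le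
  have hlim : Tendsto (fun n : ℕ => capacity ν N (fun _ => (n : ℝ≥0)) 0) atTop (𝓝 ∞) := by
    have h := lintegral_tendsto_of_tendsto_of_monotone (μ := ν)
      (f := fun (n : ℕ) x => rate N x (n : ℝ≥0) 0) (F := fun _ => ∞) (fun n =>
        (measurable_rate_comp N measurable_id measurable_const measurable_const).aemeasurable)
      (hν'.mono fun x hx m n hmn => rate_mono_left hN hx (Nat.cast_le.2 hmn) 0) ?_
    · rwa [lintegral_const, measure_univ, mul_one] at h
    · refine hν.mono fun x hx => ?_
      refine ENNReal.tendsto_ofReal_nhds_top.2 (Real.tendsto_log_atTop.comp ?_)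
      refine tendsto_atTop_add_const_left _ _ ?_
      have : (fun n : ℕ => x * (((n : ℝ≥0) : ℝ)) / (N + ((0 : ℝ≥0) : ℝ))) =
          fun n : ℕ => x / N * (n : ℝ) := by
        ext n; push_cast; ring
      rw [this]
      exact tendsto_natCast_atTop_atTop.const_mul_atTop (by positivity)
  obtain ⟨n, hn⟩ := (hlim.eventually (lt_mem_nhds
    (show ENNReal.ofReal R + ENNReal.ofReal (1 / N) * M < ∞ by finiteness))).exists
  refine ⟨n, fun q hq => le_trans ?_ (requiredJam_mono hq)⟩
  refine le_trans ?_ (jamCost_le_requiredJam (P := fun _ => (n : ℝ≥0)) measurable_const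
    (power_const _).le)
  by_contra hc
  refine hn.not_ge ((capacity_le_add_jamCost (R := R) hν' hN _).trans ?_)
  gcongr
  exact (not_le.1 hc).le

end

section

/-! ### Jamming many frames measurably -/

/-- A countable family of allocations that is dense, in mean, among the allocations of finite
power. -/
theorem exists_dense_allocations (ν : Measure ℝ) [IsProbabilityMeasure ν] :
    ∃ D : ℕ → Allocation, (∀ n, Measurable (D n)) ∧ ∀ J : Allocation, Measurable J →
      power ν J ≠ ∞ → ∀ ε : ℝ≥0∞, 0 < ε → ∃ n,
        power ν (fun x => D n x - J x) < ε ∧ power ν (fun x => J x - D n x) < ε := by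
  have : Fact ((1 : ℝ≥0∞) ≠ ∞) := ⟨ENNReal.one_ne_top⟩
  let f : ℕ → Lp ℝ 1 ν := TopologicalSpace.denseSeq _
  have hfm : ∀ n, Measurable (f n) := fun n => (Lp.stronglyMeasurable (f n)).measurable
  refine ⟨fun n x => (f n x).toNNReal, fun n => (hfm n).real_toNNReal, fun J hJ hfin ε hε => ?_⟩
  have hmem : MemLp (fun x => (J x : ℝ)) 1 ν := by
    rw [memLp_one_iff_integrable]
    refine ⟨hJ.coe_nnreal_real.aestronglyMeasurable, ?_⟩
    rw [hasFiniteIntegral_iff_enorm]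
    simpa [power, lt_top_iff_ne_top] using hfin
  obtain ⟨n, hn⟩ := (TopologicalSpace.denseRange_denseSeq (Lp ℝ 1 ν)).exists_mem_open
    (Metric.isOpen_eball (x := hmem.toLp _) (ε := ε)) ⟨_, Metric.mem_eball_self hε⟩
  have hlt : ∫⁻ x, ‖f n x - (J x : ℝ)‖ₑ ∂ν < ε := by
    rw [Metric.mem_eball, Lp.edist_def, eLpNorm_one_eq_lintegral_enorm] at hn
    refine lt_of_eq_of_lt (lintegral_congr_ae ?_) hn
    filter_upwards [hmem.coeFn_toLp] with x hx
    simp [hx, f]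
  have hle : ∀ a : ℝ, ∀ b : ℝ≥0, ((a.toNNReal - b : ℝ≥0) : ℝ≥0∞) ≤ ‖a - (b : ℝ)‖ₑ ∧
      ((b - a.toNNReal : ℝ≥0) : ℝ≥0∞) ≤ ‖a - (b : ℝ)‖ₑ := by
    intro a b
    have e : ‖a - (b : ℝ)‖ₑ = ENNReal.ofReal |a - b| := by
      rw [← Real.norm_eq_abs, ofReal_norm]
    have h0 := abs_nonneg (a - b)
    have h1 := le_abs_self (a - b)
    have h2 := neg_abs_le (a - b)
    have hb : (0 : ℝ) ≤ b := b.2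
    rw [e, ENNReal.ofReal]
    constructor <;> refine ENNReal.coe_le_coe.2 ?_ <;>
      rw [tsub_le_iff_right, ← NNReal.coe_le_coe, NNReal.coe_add, Real.coe_toNNReal _ h0,
        Real.coe_toNNReal']
    · exact max_le (by linarith) (by linarith)
    · linarith [le_max_left a 0]
  exact ⟨n, (lintegral_mono fun x => (hle _ _).1).trans_lt hlt,
    (lintegral_mono fun x => (hle _ _).2).trans_lt hlt⟩

variable {Ω : Type*} [MeasurableSpace Ω] {μ : Measure Ω} {ν : Measure ℝ} {N R : ℝ}

theorem measurable_power [SFinite ν] {T : Ω → Allocation} (hT : Measurable (Function.uncurry T)) :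
    Measurable fun ω => power ν (T ω) :=
  Measurable.lintegral_prod_right' (f := fun z : Ω × ℝ => (T z.1 z.2 : ℝ≥0∞))
    hT.coe_nnreal_ennreal

theorem measurable_capacity [SFinite ν] {T U : Ω → Allocation}
    (hT : Measurable (Function.uncurry T)) (hU : Measurable (Function.uncurry U)) :
    Measurable fun ω => capacity ν N (T ω) (U ω) :=
  Measurable.lintegral_prod_right' (f := fun z : Ω × ℝ => rate N z.2 (T z.1 z.2) (U z.1 z.2))
    (measurable_rate_comp N measurable_snd hT hU)

/-- If on the frames of `G` the jammer is granted the budget `c ω` exceeding the jamming cost, and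
the total budget `∫ c` over `G` is affordable, then some admissible jammer strategy causes an outage
on every frame of `G`.  The allocations are selected measurably from a countable dense family. -/
theorem exists_feasible_capacity_lt [IsProbabilityMeasure ν] (hν : ∀ᵐ h ∂ν, 0 ≤ h) (hN : 0 < N)
    (hR : 0 < R) {T : Ω → Allocation} (hT : Measurable (Function.uncurry T)) {G : Set Ω}
    (hG : MeasurableSet G) {c : Ω → ℝ≥0∞} (hc : Measurable c)
    (hcost : ∀ ω ∈ G, jamCost ν N R (T ω) < c ω) {B : ℝ≥0} (hB : ∫⁻ ω in G, c ω ∂μ ≤ B) :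
    ∃ U : Ω → Allocation, Feasible μ ν B U ∧
      ∀ ω ∈ G, capacity ν N (T ω) (U ω) < ENNReal.ofReal R := by
  classical
  obtain ⟨D, hDm, hD⟩ := exists_dense_allocations ν
  -- the selected allocation is the first one in the dense family that jams the frame cheaply
  let good : Ω → ℕ → Prop := fun ω n =>
    ω ∉ G ∨ (capacity ν N (T ω) (D n) < ENNReal.ofReal R ∧ power ν (D n) < c ω)
  have hex : ∀ ω, ∃ n, good ω n := by
    intro ω
    by_cases hω : ω ∈ G
    swap
    · exact ⟨0, Or.inl hω⟩
    obtain ⟨J, hJ, hC, hJc⟩ := exists_capacity_lt hν hN hR (hT.of_uncurry_left) (hcost ω hω)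
    obtain ⟨d₁, hd₁, hd₁c⟩ := ENNReal.lt_iff_exists_add_pos_lt.1 hJc
    obtain ⟨d₂, hd₂, hd₂c⟩ := ENNReal.lt_iff_exists_add_pos_lt.1 hC
    have hN' : 0 < Real.toNNReal N := Real.toNNReal_pos.2 hN
    obtain ⟨n, hn₁, hn₂⟩ := hD J hJ hJc.ne_top (min d₁ (N.toNNReal * d₂ : ℝ≥0))
      (lt_min (ENNReal.coe_pos.2 hd₁) (ENNReal.coe_pos.2 (mul_pos hN' hd₂)))
    refine ⟨n, Or.inr ⟨?_, ?_⟩⟩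
    · refine (capacity_le_capacity_add hν hN (T ω) (hDm n) hJ).trans_lt (lt_of_le_of_lt ?_ hd₂c)
      gcongr
      calc ENNReal.ofReal (1 / N) * power ν (fun x => J x - D n x)
          ≤ ENNReal.ofReal (1 / N) * ((N.toNNReal * d₂ : ℝ≥0) : ℝ≥0∞) := by
            gcongr
            exact (hn₂.trans_le (min_le_right _ _)).le
        _ = d₂ := by
            rw [ENNReal.ofReal, ← ENNReal.coe_mul, ← mul_assoc,
              ← Real.toNNReal_mul (by positivity), one_div_mul_cancel hN.ne', Real.toNNReal_one,
              one_mul]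
    · refine lt_of_le_of_lt ?_ hd₁c
      calc power ν (D n) ≤ ∫⁻ x, ((J x : ℝ≥0∞) + ((D n x - J x : ℝ≥0) : ℝ≥0∞)) ∂ν := by
            refine lintegral_mono fun x => ?_
            rw [← ENNReal.coe_add]
            exact ENNReal.coe_le_coe.2 le_add_tsub
        _ = power ν J + power ν (fun x => D n x - J x) :=
            lintegral_add_left hJ.coe_nnreal_ennreal _
        _ ≤ _ := by
            gcongr
            exact (hn₁.trans_le (min_le_left _ _)).le
  have hmeas : ∀ n, MeasurableSet {ω | good ω n} := by
    intro n
    refine hG.compl.union (MeasurableSet.inter ?_ ?_)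
    · exact measurableSet_lt (measurable_capacity (U := fun _ => D n) hT
        ((hDm n).comp measurable_snd))
        measurable_const
    · exact measurableSet_lt measurable_const hc
  have hfind : Measurable fun ω => Nat.find (hex ω) := measurable_find hex hmeas
  let U : Ω → Allocation := fun ω => if ω ∈ G then D (Nat.find (hex ω)) else 0
  have hU : Measurable (Function.uncurry U) := by
    have h1 : Measurable fun z : ℕ × ℝ => D z.1 z.2 :=
      measurable_from_prod_countable_right hDm
    have h2 : Measurable fun z : Ω × ℝ => D (Nat.find (hex z.1)) z.2 :=
      h1.comp ((hfind.comp measurable_fst).prodMk measurable_snd)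
    have h3 : Function.uncurry U =
        fun z : Ω × ℝ => if z.1 ∈ G then D (Nat.find (hex z.1)) z.2 else 0 := by
      ext z
      simp only [Function.uncurry, U]
      split_ifs <;> rfl
    rw [h3]
    exact Measurable.ite (measurable_fst hG) h2 measurable_const
  have hgood : ∀ ω ∈ G, capacity ν N (T ω) (U ω) < ENNReal.ofReal R ∧ power ν (U ω) < c ω := by
    intro ω hω
    have h := Nat.find_spec (hex ω)
    simp only [U, if_pos hω]
    exact h.resolve_left (not_not.2 hω)
  refine ⟨U, ⟨hU, le_trans ?_ hB⟩, fun ω hω => (hgood ω hω).1⟩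
  rw [← lintegral_indicator hG]
  refine lintegral_mono fun ω => ?_
  by_cases hω : ω ∈ G
  · simpa [hω] using (hgood ω hω).2.le
  · simp [hω, U, power_zero]

end

section

/-! ### A compactness principle for convex families of nonnegative functions -/

/-- Strict convexity of `x ↦ 1 / (1 + x)` on `[0, ∞)`, quantified in the coordinate `1 / (1 + x)`. -/
theorem sq_inv_sub_inv_le {x y : ℝ} (hx : 0 ≤ x) (hy : 0 ≤ y) :
    ((1 + x)⁻¹ - (1 + y)⁻¹) ^ 2 ≤
      2 * ((1 + x)⁻¹ + (1 + y)⁻¹) - 4 * (1 + (x + y) / 2)⁻¹ := by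
  have ha : 0 < 1 + x := by linarith
  have hb : 0 < 1 + y := by linarith
  have hab : 0 < 1 + (x + y) / 2 := by linarith
  have e : 2 * ((1 + x)⁻¹ + (1 + y)⁻¹) - 4 * (1 + (x + y) / 2)⁻¹ - ((1 + x)⁻¹ - (1 + y)⁻¹) ^ 2
      = (x - y) ^ 2 * (x + y + 2 * x * y) / ((1 + x) ^ 2 * (1 + y) ^ 2 * (2 + (x + y))) := by
    field_simp
    ring
  have : 0 ≤ (x - y) ^ 2 * (x + y + 2 * x * y) / ((1 + x) ^ 2 * (1 + y) ^ 2 * (2 + (x + y))) := by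
    positivity
  linarith

/-- A decreasing sequence of nonempty midpoint convex families of nonnegative functions, bounded in
mean, admits an almost everywhere convergent choice of members.  Approximate minimizers of the
strictly convex functional `∫ 1 / (1 + f)` form a Cauchy sequence in the coordinate
`1 / (1 + f)`, and the bound on the means keeps the limit finite. -/
theorem exists_ae_tendsto_of_midpoint_convex {α : Type*} [MeasurableSpace α] (ν : Measure α)
    [IsProbabilityMeasure ν] {K : ℕ → Set (α → ℝ≥0)} (hK : Antitone K)
    (hne : ∀ n, (K n).Nonempty) (hm : ∀ n, ∀ f ∈ K n, Measurable f)
    (hmid : ∀ n, ∀ f ∈ K n, ∀ g ∈ K n, (fun x => (f x + g x) / 2) ∈ K n)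
    {M : ℝ≥0∞} (hM : M ≠ ∞) (hb : ∀ f ∈ K 0, ∫⁻ x, (f x : ℝ≥0∞) ∂ν ≤ M) :
    ∃ (g : ℕ → α → ℝ≥0) (P : α → ℝ≥0), (∀ n, g n ∈ K n) ∧ Measurable P ∧
      ∀ᵐ x ∂ν, Tendsto (fun n => g n x) atTop (𝓝 (P x)) := by
  let ψ : (α → ℝ≥0) → α → ℝ := fun f x => (1 + (f x : ℝ))⁻¹
  have hψ0 : ∀ f x, 0 ≤ ψ f x := fun f x => by positivity
  have hψ1 : ∀ f x, ψ f x ≤ 1 := fun f x => inv_le_one_of_one_le₀ (by simp)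
  have hψm : ∀ f, Measurable f → Measurable (ψ f) := fun f hf =>
    (hf.coe_nnreal_real.const_add 1).inv
  have hψi : ∀ f, Measurable f → Integrable (ψ f) ν := fun f hf =>
    Integrable.of_bound (hψm f hf).aestronglyMeasurable 1 (Eventually.of_forall fun x => by
      rw [Real.norm_of_nonneg (hψ0 f x)]; exact hψ1 f x)
  let Φ : (α → ℝ≥0) → ℝ := fun f => ∫ x, ψ f x ∂ν
  have hΦ0 : ∀ f, 0 ≤ Φ f := fun f => integral_nonneg (hψ0 f)
  have hΦ1 : ∀ f, Measurable f → Φ f ≤ 1 := fun f hf => by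
    have := integral_mono (hψi f hf) (integrable_const 1) (hψ1 f)
    simpa using this
  let I : ℕ → ℝ := fun n => sInf (Φ '' K n)
  have hbdd : ∀ n, BddBelow (Φ '' K n) := fun n => ⟨0, by rintro _ ⟨f, -, rfl⟩; exact hΦ0 f⟩
  have hIle : ∀ n, ∀ f ∈ K n, I n ≤ Φ f := fun n f hf => csInf_le (hbdd n) ⟨f, hf, rfl⟩
  have hImono : Monotone I := fun m n hmn =>
    csInf_le_csInf (hbdd m) ((hne n).image _) (image_mono (hK hmn))
  have hI1 : ∀ n, I n ≤ 1 := fun n => by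
    obtain ⟨f, hf⟩ := hne n
    exact (hIle n f hf).trans (hΦ1 f (hm n f hf))
  have hchoose : ∀ n : ℕ, ∃ f ∈ K n, Φ f < I n + 1 / (n + 1) := fun n => by
    obtain ⟨_, ⟨f, hf, rfl⟩, hlt⟩ := exists_lt_of_csInf_lt ((hne n).image Φ)
      (lt_add_of_pos_right (I n) (Nat.one_div_pos_of_nat (α := ℝ) (n := n)))
    exact ⟨f, hf, hlt⟩
  choose g hgK hgΦ using hchoose
  have hgm : ∀ n, Measurable (g n) := fun n => hm n _ (hgK n)
  have hgap : ∀ m n, m ≤ n → ∫ x, (ψ (g n) x - ψ (g m) x) ^ 2 ∂ν ≤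
      2 * (I n - I m) + 4 * (1 / ((m : ℝ) + 1)) := by
    intro m n hmn
    -- the midpoint of `g n` and `g m` also competes for the infimum `I m`
    have hmidK := hmid m (g n) (hK hmn (hgK n)) (g m) (hgK m)
    set mid : α → ℝ≥0 := fun x => (g n x + g m x) / 2
    have hi1 := hψi _ (hgm n)
    have hi2 := hψi _ (hgm m)
    have hi3 := hψi _ (hm m _ hmidK)
    have h1 : ∫ x, (ψ (g n) x - ψ (g m) x) ^ 2 ∂ν ≤
        ∫ x, (2 * (ψ (g n) x + ψ (g m) x) - 4 * ψ mid x) ∂ν := by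
      refine integral_mono_of_nonneg (Eventually.of_forall fun x => sq_nonneg _)
        (((hi1.add hi2).const_mul 2).sub (hi3.const_mul 4)) (Eventually.of_forall fun x => ?_)
      have := sq_inv_sub_inv_le (g n x).2 (g m x).2
      simpa [ψ, mid] using this
    have h2 : ∫ x, (2 * (ψ (g n) x + ψ (g m) x) - 4 * ψ mid x) ∂ν =
        2 * (Φ (g n) + Φ (g m)) - 4 * Φ mid := by
      have hi4 : Integrable (fun x => 2 * (ψ (g n) x + ψ (g m) x)) ν := (hi1.add hi2).const_mul 2
      rw [integral_sub hi4 (hi3.const_mul 4), integral_const_mul, integral_const_mul,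
        integral_add hi1 hi2]
    have h3 := hIle m mid hmidK
    have h4 := hgΦ n
    have h5 := hgΦ m
    have h6 : 1 / ((n : ℝ) + 1) ≤ 1 / ((m : ℝ) + 1) := Nat.one_div_le_one_div hmn
    linarith
  have hmemLp : ∀ n, MemLp (ψ (g n)) 2 ν := fun n =>
    MemLp.of_bound (hψm _ (hgm n)).aestronglyMeasurable 1 (Eventually.of_forall fun x => by
      rw [Real.norm_of_nonneg (hψ0 _ x)]; exact hψ1 _ x)
  have hcauchy : CauchySeq fun n => (hmemLp n).toLp (ψ (g n)) := by
    have hIc : CauchySeq I :=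
      (tendsto_atTop_ciSup hImono ⟨1, by rintro _ ⟨n, rfl⟩; exact hI1 n⟩).cauchySeq
    have hdist : ∀ m n, dist ((hmemLp n).toLp (ψ (g n))) ((hmemLp m).toLp (ψ (g m))) ^ 2 =
        ∫ x, (ψ (g n) x - ψ (g m) x) ^ 2 ∂ν := by
      intro m n
      rw [dist_eq_norm, ← MemLp.toLp_sub, ← real_inner_self_eq_norm_sq, L2.inner_def]
      refine integral_congr_ae ?_
      filter_upwards [((hmemLp n).sub (hmemLp m)).coeFn_toLp] with x hx
      rw [hx]
      simp [sq]
    refine Metric.cauchySeq_iff'.2 fun ε hε => ?_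
    obtain ⟨m₁, hm₁⟩ := Metric.cauchySeq_iff.1 hIc (ε ^ 2 / 8) (by positivity)
    obtain ⟨m₂, hm₂⟩ := exists_nat_one_div_lt (show 0 < ε ^ 2 / 16 by positivity)
    refine ⟨max m₁ m₂, fun n hn => ?_⟩
    have h1 := hgap _ n hn
    have h2 := hm₁ n (le_of_max_le_left hn) (max m₁ m₂) (le_max_left _ _)
    rw [Real.dist_eq] at h2
    have h3 := le_abs_self (I n - I (max m₁ m₂))
    have h4 : 1 / (((max m₁ m₂ : ℕ) : ℝ) + 1) ≤ 1 / ((m₂ : ℝ) + 1) :=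
      Nat.one_div_le_one_div (le_max_right _ _)
    rw [← hdist] at h1
    refine lt_of_pow_lt_pow_left₀ 2 hε.le ?_
    have : 0 < ε ^ 2 := by positivity
    linarith
  obtain ⟨F, hF⟩ := cauchySeq_tendsto_of_complete hcauchy
  obtain ⟨ns, hns, hae⟩ := (tendstoInMeasure_of_tendsto_Lp hF).exists_seq_tendsto_ae
  have hae' : ∀ᵐ x ∂ν, Tendsto (fun k => ψ (g (ns k)) x) atTop (𝓝 (F x)) := by
    filter_upwards [hae, ae_all_iff.2 fun n => (hmemLp n).coeFn_toLp] with x hx hx'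
    simpa only [hx'] using hx
  have hfat : ∫⁻ x, liminf (fun k => (g (ns k) x : ℝ≥0∞)) atTop ∂ν ≤ M := by
    refine (lintegral_liminf_le fun k => (hgm _).coe_nnreal_ennreal).trans ?_
    refine liminf_le_of_le (by isBoundedDefault) fun b hb' => ?_
    obtain ⟨k, hk⟩ := hb'.exists
    exact hk.trans (hb _ (hK (Nat.zero_le _) (hgK _)))
  have hfin : ∀ᵐ x ∂ν, liminf (fun k => (g (ns k) x : ℝ≥0∞)) atTop < ∞ :=
    ae_lt_top (Measurable.liminf fun k => (hgm _).coe_nnreal_ennreal) (hfat.trans_lt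
      (lt_top_iff_ne_top.2 hM)).ne
  refine ⟨fun k => g (ns k), fun x => ((F x)⁻¹ - 1).toNNReal, fun k => hK (hns.id_le k) (hgK _),
    (((Lp.stronglyMeasurable F).measurable.inv).sub_const 1).real_toNNReal, ?_⟩
  filter_upwards [hae', hfin] with x hx hfx
  have hinv : ∀ k, (g (ns k) x : ℝ) = (ψ (g (ns k)) x)⁻¹ - 1 := fun k => by simp [ψ]
  -- where the limit vanished, `g` would tend to infinity, against Fatou's lemma
  have hFx : F x ≠ 0 := by
    intro h0
    rw [h0] at hx
    have h1 : Tendsto (fun k => ((g (ns k) x : ℝ≥0) : ℝ)) atTop atTop := by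
      simp only [hinv]
      refine tendsto_atTop_add_const_right _ _ (Tendsto.inv_tendsto_nhdsGT_zero ?_)
      exact tendsto_nhdsWithin_iff.2 ⟨hx, Eventually.of_forall fun k =>
        mem_Ioi.2 (show 0 < (1 + (g (ns k) x : ℝ))⁻¹ by positivity)⟩
    have h2 : Tendsto (fun k => (g (ns k) x : ℝ≥0∞)) atTop (𝓝 ∞) := by
      simpa using ENNReal.tendsto_ofReal_nhds_top.2 h1
    exact hfx.ne h2.liminf_eq
  have h3 : Tendsto (fun k => ((g (ns k) x : ℝ≥0) : ℝ)) atTop (𝓝 ((F x)⁻¹ - 1)) := by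
    simp only [hinv]
    exact (hx.inv₀ hFx).sub_const 1
  simpa [Function.comp_def] using (continuous_real_toNNReal.tendsto _).comp h3

end

section

/-! ### Existence of optimal allocations -/

variable {ν : Measure ℝ} {N R : ℝ}

/-- Along an almost everywhere convergent sequence of allocations of bounded power, the capacity is
upper semicontinuous, provided `log (1 + h)` is integrable: up to the error `k⁻¹ M` the rates are
dominated by an integrable function. -/
theorem le_capacity_of_tendsto [IsProbabilityMeasure ν] (hν : ∀ᵐ h ∂ν, 0 ≤ h) (hN : 0 < N)
    (hfin : ∫⁻ h, ENNReal.ofReal (Real.log (1 + h)) ∂ν ≠ ∞) {g : ℕ → Allocation}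
    (hg : ∀ n, Measurable (g n)) {M : ℝ≥0∞} (hM : M ≠ ∞) (hgM : ∀ n, power ν (g n) ≤ M)
    {P J : Allocation} (hJ : Measurable J)
    (hlim : ∀ᵐ x ∂ν, Tendsto (fun n => g n x) atTop (𝓝 (P x))) {r : ℝ≥0∞}
    (hr : ∀ᶠ n in atTop, r ≤ capacity ν N (g n) J) : r ≤ capacity ν N P J := by
  have key : ∀ k : ℕ, r ≤ capacity ν N P J + ENNReal.ofReal ((k : ℝ) + 1)⁻¹ * M := by
    intro k
    -- the rate exceeds the integrable majorant `D` by at most a small multiple of the power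
    let D : ℝ → ℝ≥0∞ := fun h => ENNReal.ofReal (Real.log (1 + h)) +
      ENNReal.ofReal (Real.log (1 + 1 / N) + Real.log ((k : ℝ) + 1))
    have hDfin : ∫⁻ h, D h ∂ν ≠ ∞ := by
      rw [lintegral_add_right _ measurable_const]
      simp [hfin]
    have hmeas : ∀ n, Measurable fun x => min (rate N x (g n x) (J x)) (D x) := fun n =>
      (measurable_rate_comp N measurable_id (hg n) hJ).min
        (show Measurable D by unfold D; fun_prop)
    have hle : ∀ n, capacity ν N (g n) J ≤
        ∫⁻ x, min (rate N x (g n x) (J x)) (D x) ∂ν + ENNReal.ofReal ((k : ℝ) + 1)⁻¹ * M := by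
      intro n
      calc capacity ν N (g n) J ≤ ∫⁻ x, (min (rate N x (g n x) (J x)) (D x) +
            ENNReal.ofReal ((k : ℝ) + 1)⁻¹ * (g n x : ℝ≥0∞)) ∂ν := by
            refine lintegral_mono_ae (hν.mono fun x hx => ?_)
            change rate N x (g n x) (J x) ≤ _
            rcases le_total (rate N x (g n x) (J x)) (D x) with h | h
            · rw [min_eq_left h]; exact le_self_add
            · rw [min_eq_right h]
              exact rate_le_log_add hN hx (by simp) (g n x) (J x)
        _ = ∫⁻ x, min (rate N x (g n x) (J x)) (D x) ∂ν +
            ENNReal.ofReal ((k : ℝ) + 1)⁻¹ * power ν (g n) := by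
            rw [lintegral_add_left (hmeas n), power, lintegral_const_mul _
              (hg n).coe_nnreal_ennreal]
        _ ≤ _ := by gcongr; exact hgM n
    have hconv : Tendsto (fun n => ∫⁻ x, min (rate N x (g n x) (J x)) (D x) ∂ν) atTop
        (𝓝 (∫⁻ x, min (rate N x (P x) (J x)) (D x) ∂ν)) := by
      refine tendsto_lintegral_of_dominated_convergence D hmeas
        (fun n => Eventually.of_forall fun x => min_le_right _ _) hDfin ?_
      filter_upwards [hlim, hν] with x hx hx0
      refine Tendsto.min ?_ tendsto_const_nhds
      refine (ENNReal.continuous_ofReal.tendsto _).comp ?_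
      have hj : 0 < N + (J x : ℝ) := by positivity
      refine Tendsto.log ?_ (by positivity)
      exact (((NNReal.tendsto_coe.2 hx).const_mul x).div_const _).const_add 1
    refine ge_of_tendsto ?_ (hr.mono fun n hn => hn.trans (hle n)) |>.trans
      (add_le_add_left (lintegral_mono fun x => min_le_left (rate N x (P x) (J x)) (D x)) _)
    exact hconv.add tendsto_const_nhds
  have hlim0 : Tendsto (fun k : ℕ => capacity ν N P J + ENNReal.ofReal ((k : ℝ) + 1)⁻¹ * M) atTop
      (𝓝 (capacity ν N P J + 0 * M)) := by
    refine tendsto_const_nhds.add (ENNReal.Tendsto.mul_const ?_ (Or.inr hM))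
    have := (ENNReal.continuous_ofReal.tendsto _).comp
      (tendsto_one_div_add_atTop_nhds_zero_nat (𝕜 := ℝ))
    simpa [Function.comp_def] using this
  rw [zero_mul, add_zero] at hlim0
  exact ge_of_tendsto' hlim0 key

/-- If `log (1 + h)` is integrable, any jamming cost that is required at every power level above `q`
is forced by an allocation of power at most `q`.  This yields both the existence of optimal
allocations and the right continuity of the required jamming power. -/
theorem exists_le_jamCost_of_forall_gt [IsProbabilityMeasure ν] (hν : ∀ᵐ h ∂ν, 0 ≤ h)
    (hN : 0 < N) (hR : 0 < R) (hfin : ∫⁻ h, ENNReal.ofReal (Real.log (1 + h)) ∂ν ≠ ∞)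
    {q : ℝ≥0} {v : ℝ≥0∞} (hq : ∀ q', q < q' → v ≤ requiredJam ν N R q') :
    ∃ P : Allocation, Measurable P ∧ power ν P ≤ q ∧ v ≤ jamCost ν N R P := by
  rcases eq_or_ne v 0 with rfl | hv
  · exact ⟨0, measurable_const, by simp [power_zero], zero_le⟩
  obtain ⟨u, hu, huv, hulim⟩ := exists_seq_strictMono_tendsto' (pos_iff_ne_zero.2 hv)
  let K : ℕ → Set Allocation := fun n => {P | Measurable P ∧
    power ν P ≤ q + ((n : ℝ≥0∞) + 1)⁻¹ ∧ ∀ J : Allocation, Measurable J → power ν J < u n →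
      ENNReal.ofReal R < capacity ν N P J}
  have hK : Antitone K := by
    intro m n hmn P hP
    refine ⟨hP.1, hP.2.1.trans ?_, fun J hJ hlt => hP.2.2 J hJ (hlt.trans_le (hu.monotone hmn))⟩
    gcongr
  have hne : ∀ n, (K n).Nonempty := by
    intro n
    have h1 := (huv n).2.trans_le (hq (q + ((n : ℝ≥0) + 1)⁻¹) (lt_add_of_pos_right q (by positivity)))
    obtain ⟨P, hP, hPq, hPu⟩ := lt_requiredJam_iff.1 h1
    refine ⟨P, hP, hPq.trans_eq ?_, fun J hJ hlt => ?_⟩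
    · rw [ENNReal.coe_add, ENNReal.coe_inv (by positivity)]
      simp
    · by_contra hc
      exact (hPu.trans_le (jamCost_le hJ (not_lt.1 hc))).not_gt hlt
  have hmid : ∀ n, ∀ f ∈ K n, ∀ g ∈ K n, (fun x => (f x + g x) / 2) ∈ K n := by
    intro n f hf g hg
    refine ⟨(hf.1.add hg.1).div_const 2, ?_, fun J hJ hlt => ?_⟩
    · have e : power ν (fun x => (f x + g x) / 2) = 2⁻¹ * (power ν f + power ν g) := by
        simp only [div_eq_inv_mul]
        rw [power_mul (show Measurable fun x => f x + g x from hf.1.add hg.1), power_add hf.1,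
          ENNReal.coe_inv two_ne_zero]
        rfl
      rw [e]
      calc 2⁻¹ * (power ν f + power ν g) ≤
            2⁻¹ * ((q + ((n : ℝ≥0∞) + 1)⁻¹) + (q + ((n : ℝ≥0∞) + 1)⁻¹)) := by
            gcongr
            exacts [hf.2.1, hg.2.1]
        _ = _ := by
            rw [← two_mul, ← mul_assoc, ENNReal.inv_mul_cancel (by simp) (by simp), one_mul]
    · by_contra hc
      have h1 := capacity_add_capacity_le hν hN hf.1 hg.1 hJ
      have h2 := ENNReal.add_lt_add (hf.2.2 J hJ hlt) (hg.2.2 J hJ hlt)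
      refine (h2.trans_le h1).not_ge ?_
      rw [← two_mul]
      gcongr
      exact not_lt.1 hc
  obtain ⟨g, P, hgK, hP, hae⟩ := exists_ae_tendsto_of_midpoint_convex ν hK hne
    (fun n f hf => hf.1) hmid (M := q + 1) (by finiteness) (fun f hf => by
      have h := hf.2.1
      rwa [Nat.cast_zero, zero_add, inv_one] at h)
  refine ⟨P, hP, ?_, ?_⟩
  · have h1 : ∫⁻ x, liminf (fun n => (g n x : ℝ≥0∞)) atTop ∂ν ≤
        liminf (fun n => power ν (g n)) atTop :=
      lintegral_liminf_le fun n => (hgK n).1.coe_nnreal_ennreal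
    have h2 : power ν P = ∫⁻ x, liminf (fun n => (g n x : ℝ≥0∞)) atTop ∂ν :=
      lintegral_congr_ae (hae.mono fun x hx => (ENNReal.tendsto_coe.2 hx).liminf_eq.symm)
    have h3 : Tendsto (fun n : ℕ => (q : ℝ≥0∞) + ((n : ℝ≥0∞) + 1)⁻¹) atTop (𝓝 (q + 0)) := by
      refine tendsto_const_nhds.add ?_
      have := (tendsto_add_atTop_iff_nat 1).2 ENNReal.tendsto_inv_nat_nhds_zero
      simpa using this
    rw [add_zero] at h3
    rw [h2, ← h3.liminf_eq]
    exact h1.trans (liminf_le_liminf (Eventually.of_forall fun n => (hgK n).2.1))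
  · by_contra hc
    obtain ⟨J, hJ, hC, hJv⟩ := exists_capacity_lt hν hN hR hP (not_le.1 hc)
    refine hC.not_ge (le_capacity_of_tendsto hν hN hfin (fun n => (hgK n).1) (M := q + 1)
      (by finiteness) (fun n => ?_) hJ hae ?_)
    · refine (hgK n).2.1.trans ?_
      gcongr
      simp
    · filter_upwards [hulim.eventually (lt_mem_nhds hJv)] with n hn
      exact ((hgK n).2.2 J hJ hn).le

/-- If `log (1 + h)` is not integrable, no jammer of finite power can bring the capacity of a
constant positive power down to `R`. -/
theorem jamCost_const_eq_top [IsProbabilityMeasure ν] (hν : ∀ᵐ h ∂ν, 0 ≤ h) (hN : 0 < N)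
    (hinf : ∫⁻ h, ENNReal.ofReal (Real.log (1 + h)) ∂ν = ∞) {q : ℝ≥0} (hq : 0 < q) :
    jamCost ν N R (fun _ => q) = ∞ := by
  have h1 : capacity ν N (fun _ => q) 0 = ∞ := by
    by_contra hc
    have h2 : ∫⁻ h, ENNReal.ofReal (Real.log (1 + h)) ∂ν ≤
        capacity ν N (fun _ => q) 0 + ENNReal.ofReal (Real.log (1 + N / q)) := by
      calc _ ≤ ∫⁻ h, (rate N h q 0 + ENNReal.ofReal (Real.log (1 + N / q))) ∂ν :=
            lintegral_mono_ae (hν.mono fun x hx => ofReal_log_le_rate_add hN hx hq)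
        _ = _ := by
            rw [lintegral_add_right _ measurable_const, lintegral_const, measure_univ, mul_one]
            rfl
    rw [hinf, top_le_iff] at h2
    exact (ENNReal.add_ne_top.2 ⟨hc, ENNReal.ofReal_ne_top⟩) h2
  have h3 := capacity_le_add_jamCost (R := R) hν hN (fun _ => q)
  rw [h1, top_le_iff] at h3
  by_contra hc
  exact (ENNReal.add_ne_top.2 ⟨ENNReal.ofReal_ne_top,
    ENNReal.mul_ne_top ENNReal.ofReal_ne_top hc⟩) h3

/-- The required jamming power is right continuous at every positive power level. -/
theorem le_requiredJam_of_forall_gt [IsProbabilityMeasure ν] (hν : ∀ᵐ h ∂ν, 0 ≤ h)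
    (hN : 0 < N) (hR : 0 < R) {q : ℝ≥0} (hq : 0 < q) {v : ℝ≥0∞}
    (hv : ∀ q', q < q' → v ≤ requiredJam ν N R q') : v ≤ requiredJam ν N R q := by
  by_cases hfin : ∫⁻ h, ENNReal.ofReal (Real.log (1 + h)) ∂ν = ∞
  · have h := jamCost_le_requiredJam (ν := ν) (N := N) (R := R) (P := fun _ => q)
      measurable_const (power_const q).le
    rw [jamCost_const_eq_top hν hN hfin hq, top_le_iff] at h
    simp [h]
  · obtain ⟨P, hP, hPq, hPv⟩ := exists_le_jamCost_of_forall_gt hν hN hR hfin hv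
    exact hPv.trans (jamCost_le_requiredJam hP hPq)

theorem exists_isOptimalAllocation [IsProbabilityMeasure ν] (hν : ∀ᵐ h ∂ν, 0 ≤ h)
    (hN : 0 < N) (hR : 0 < R) {q : ℝ≥0} (hq : 0 < q) :
    ∃ P : Allocation, IsOptimalAllocation ν N R q P := by
  by_cases hfin : ∫⁻ h, ENNReal.ofReal (Real.log (1 + h)) ∂ν = ∞
  · refine ⟨fun _ => q, measurable_const, power_const q, ?_⟩
    refine le_antisymm (jamCost_le_requiredJam measurable_const (power_const q).le) ?_
    rw [jamCost_const_eq_top hν hN hfin hq]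
    exact le_top
  · obtain ⟨P, hP, hPq, hPv⟩ := exists_le_jamCost_of_forall_gt hν hN hR hfin
      (fun q' hq' => requiredJam_mono (ν := ν) (N := N) (R := R) hq'.le)
    -- unused power is spread evenly over the channel states
    have hd : (((q : ℝ≥0∞) - power ν P).toNNReal : ℝ≥0∞) = q - power ν P :=
      ENNReal.coe_toNNReal (by finiteness)
    have hpow : power ν (fun x => P x + ((q : ℝ≥0∞) - power ν P).toNNReal) = q := by
      rw [power_add_const, hd, add_tsub_cancel_of_le hPq]
    have hm : Measurable fun x => P x + ((q : ℝ≥0∞) - power ν P).toNNReal := hP.add_const _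
    exact ⟨_, hm, hpow, le_antisymm (jamCost_le_requiredJam hm hpow.le)
      (hPv.trans (jamCost_mono hν hN fun x => le_self_add))⟩

end

section

/-! ### Sets of prescribed measure -/

variable {Ω : Type*} [MeasurableSpace Ω] {μ : Measure Ω}

/-- Existence of quantiles. -/
theorem exists_measure_lt_le_measure_le [IsFiniteMeasure μ] {x : Ω → ℝ} (hx : Measurable x)
    {s : ℝ≥0∞} (hs0 : 0 < s) (hs : s < μ univ) :
    ∃ t, μ {ω | x ω < t} ≤ s ∧ s ≤ μ {ω | x ω ≤ t} := by
  let ρ : Measure ℝ := μ.map x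
  have hρ : ∀ t, ρ (Iic t) = μ {ω | x ω ≤ t} := fun t => Measure.map_apply hx measurableSet_Iic
  have hρ' : ∀ t, ρ (Iio t) = μ {ω | x ω < t} := fun t => Measure.map_apply hx measurableSet_Iio
  have hmono : ∀ {a b : ℝ}, a ≤ b → ρ (Iic a) ≤ ρ (Iic b) := fun h =>
    measure_mono (Iic_subset_Iic.2 h)
  have hbot : Tendsto (fun a => ρ (Iic a)) atBot (𝓝 0) := by
    have h := tendsto_measure_iInter_atBot (μ := ρ) (s := fun a : ℝ => Iic a)
      (fun _ => measurableSet_Iic.nullMeasurableSet) (fun _ _ h => Iic_subset_Iic.2 h)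
      ⟨0, measure_ne_top _ _⟩
    rwa [iInter_Iic_eq_empty_iff.2 (by simp), measure_empty] at h
  have htop : Tendsto (fun a => ρ (Iic a)) atTop (𝓝 (μ univ)) := by
    have h := tendsto_measure_Iic_atTop ρ
    rwa [show ρ univ = μ univ from Measure.map_apply hx MeasurableSet.univ] at h
  obtain ⟨a, ha⟩ := (hbot.eventually (gt_mem_nhds hs0)).exists
  obtain ⟨b, hb⟩ := (htop.eventually (lt_mem_nhds hs)).exists
  have hbdd : BddBelow {t | s ≤ ρ (Iic t)} := ⟨a, fun t ht => by
    by_contra hc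
    exact (lt_of_le_of_lt ht (lt_of_le_of_lt (hmono (not_le.1 hc).le) ha)).false⟩
  set t := sInf {t | s ≤ ρ (Iic t)}
  refine ⟨t, ?_, ?_⟩
  · obtain ⟨v, hv, hvt, hvlim⟩ := exists_seq_strictMono_tendsto t
    have : Iio t = ⋃ n, Iic (v n) := by
      ext y
      simp only [mem_Iio, mem_iUnion, mem_Iic]
      exact ⟨fun h => ((hvlim.eventually (lt_mem_nhds h)).exists).imp fun _ => le_of_lt,
        fun ⟨n, h⟩ => h.trans_lt (hvt n)⟩
    rw [← hρ', this]
    exact le_of_tendsto' (tendsto_measure_iUnion_atTop fun m n hmn =>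
      Iic_subset_Iic.2 (hv.monotone hmn)) fun n =>
        (not_le.1 fun h => (csInf_le hbdd h).not_gt (hvt n)).le
  · obtain ⟨u, hu, hut, hulim⟩ := exists_seq_strictAnti_tendsto t
    have : Iic t = ⋂ n, Iic (u n) := by
      ext y
      simp only [mem_iInter, mem_Iic]
      exact ⟨fun h n => h.trans (hut n).le, fun h => ge_of_tendsto' hulim h⟩
    rw [← hρ, this]
    refine ge_of_tendsto' (tendsto_measure_iInter_atTop
      (fun n => measurableSet_Iic.nullMeasurableSet)
      (fun m n hmn => Iic_subset_Iic.2 (hu.antitone hmn)) ⟨0, measure_ne_top _ _⟩) fun n => ?_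
    obtain ⟨r, hr, hrn⟩ := exists_lt_of_csInf_lt ⟨b, hb.le⟩ (hut n)
    exact le_trans hr (hmono hrn.le)

/-- An atomless finite measure on a standard Borel space takes every value between `0` and `μ E` on
the measurable subsets of `E`: intersect `E` with a sublevel set of a measurable embedding into
`ℝ`, whose level sets are null. -/
theorem exists_measurableSet_subset_measure_eq [StandardBorelSpace Ω] [IsFiniteMeasure μ]
    [NullSingletonClass μ] {E : Set Ω} (hE : MeasurableSet E) {s : ℝ≥0∞} (hs : s ≤ μ E) :
    ∃ G ⊆ E, MeasurableSet G ∧ μ G = s := by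
  rcases eq_or_ne s 0 with rfl | hs0
  · exact ⟨∅, empty_subset _, MeasurableSet.empty, measure_empty⟩
  rcases hs.eq_or_lt with rfl | hs1
  · exact ⟨E, Subset.rfl, hE, rfl⟩
  have he := measurableEmbedding_embeddingReal Ω
  obtain ⟨t, ht1, ht2⟩ := exists_measure_lt_le_measure_le (μ := μ.restrict E) he.measurable
    (pos_iff_ne_zero.2 hs0) (by simpa using hs1)
  have hm : MeasurableSet {ω | embeddingReal Ω ω ≤ t} :=
    measurableSet_le he.measurable measurable_const
  have hnull : μ.restrict E {ω | embeddingReal Ω ω = t} = 0 :=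
    nonpos_iff_eq_zero.1 ((Measure.restrict_apply_le _ _).trans_eq
      (Set.Subsingleton.measure_zero (fun a ha b hb => he.injective (ha.trans hb.symm)) μ))
  refine ⟨{ω | embeddingReal Ω ω ≤ t} ∩ E, inter_subset_right, hm.inter hE, ?_⟩
  rw [← Measure.restrict_apply hm]
  refine le_antisymm ?_ ht2
  have : {ω | embeddingReal Ω ω ≤ t} ⊆
      {ω | embeddingReal Ω ω < t} ∪ {ω | embeddingReal Ω ω = t} := fun ω hω =>
    (show embeddingReal Ω ω ≤ t from hω).lt_or_eq
  calc _ ≤ μ.restrict E {ω | embeddingReal Ω ω < t} +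
        μ.restrict E {ω | embeddingReal Ω ω = t} := (measure_mono this).trans (measure_union_le _ _)
    _ ≤ s := by rw [hnull, add_zero]; exact ht1

/-- For an atomless probability measure, a set of measure `s` on which the function `x` takes its
smallest values. -/
theorem exists_measurableSet_measure_eq_le_threshold [StandardBorelSpace Ω]
    [IsProbabilityMeasure μ] [NullSingletonClass μ] {x : Ω → ℝ≥0} (hx : Measurable x)
    {s : ℝ≥0∞} (hs : s < 1) :
    ∃ (G : Set Ω) (t : ℝ≥0), MeasurableSet G ∧ μ G = s ∧ (∀ ω ∈ G, x ω ≤ t) ∧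
      ∀ ω ∉ G, t ≤ x ω := by
  rcases eq_or_ne s 0 with rfl | hs0
  · exact ⟨∅, 0, MeasurableSet.empty, measure_empty, by simp, by simp⟩
  obtain ⟨t, hdown, hup⟩ := exists_measure_lt_le_measure_le (μ := μ) hx.coe_nnreal_real
    (pos_iff_ne_zero.2 hs0) (by simpa using hs)
  have ht0 : 0 ≤ t := by
    by_contra hc
    have : {ω | (x ω : ℝ) ≤ t} = ∅ :=
      eq_empty_of_forall_notMem fun ω hω => hc ((x ω).2.trans hω)
    rw [this, measure_empty] at hup
    exact hs0 (nonpos_iff_eq_zero.1 hup)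
  have hmD : MeasurableSet {ω | (x ω : ℝ) < t} :=
    measurableSet_lt hx.coe_nnreal_real measurable_const
  have hmU : MeasurableSet {ω | (x ω : ℝ) ≤ t} :=
    measurableSet_le hx.coe_nnreal_real measurable_const
  obtain ⟨G, hGsub, hG, hGs⟩ := exists_measurableSet_subset_measure_eq (μ := μ)
    (E := {ω | (x ω : ℝ) ≤ t} \ {ω | (x ω : ℝ) < t}) (hmU.diff hmD)
    (s := s - μ {ω | (x ω : ℝ) < t})
    ((tsub_le_tsub_right hup _).trans le_measure_sdiff)
  refine ⟨{ω | (x ω : ℝ) < t} ∪ G, ⟨t, ht0⟩, hmD.union hG, ?_, ?_, ?_⟩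
  · rw [measure_union (disjoint_left.2 fun ω h1 h2 => (hGsub h2).2 h1) hG, hGs,
      add_tsub_cancel_of_le hdown]
  · rintro ω (hω | hω)
    · exact NNReal.coe_le_coe.1 (le_of_lt hω)
    · exact NNReal.coe_le_coe.1 (hGsub hω).1
  · intro ω hω
    exact NNReal.coe_le_coe.1 (not_lt.1 fun h => hω (Or.inl h))

end

section

/-! ### Worst-case outage of ON/OFF strategies -/

theorem onOff_of_mem {Ω : Type*} {S : Set Ω} {ω : Ω} (h : ω ∈ S) (P : Allocation) :
    onOff S P ω = P :=
  if_pos h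

theorem onOff_of_notMem {Ω : Type*} {S : Set Ω} {ω : Ω} (h : ω ∉ S) (P : Allocation) :
    onOff S P ω = 0 :=
  if_neg h

variable {Ω : Type*} [MeasurableSpace Ω] {μ : Measure Ω} {ν : Measure ℝ} {N R : ℝ} {A B : ℝ≥0}

theorem measurable_uncurry_onOff {S : Set Ω} (hS : MeasurableSet S) {P : Allocation}
    (hP : Measurable P) : Measurable (Function.uncurry (onOff S P)) := by
  classical
  have h : Function.uncurry (onOff S P) = fun z : Ω × ℝ => if z.1 ∈ S then P z.2 else 0 := by
    ext z
    by_cases hz : z.1 ∈ S <;> simp [Function.uncurry, onOff, hz]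
  rw [h]
  exact Measurable.ite (measurable_fst hS) (hP.comp measurable_snd) measurable_const

theorem lintegral_power_onOff {S : Set Ω} (hS : MeasurableSet S) (P : Allocation) :
    ∫⁻ ω, power ν (onOff S P ω) ∂μ = power ν P * μ S := by
  rw [← lintegral_indicator_const hS]
  refine lintegral_congr fun ω => ?_
  by_cases hω : ω ∈ S
  · simp [hω, onOff_of_mem]
  · simp [hω, onOff_of_notMem, power_zero]

theorem feasible_onOff_iff {S : Set Ω} (hS : MeasurableSet S) {PM : ℝ≥0} (hPM : 0 < PM)
    {P : Allocation} (hP : IsOptimalAllocation ν N R PM P) :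
    Feasible μ ν A (onOff S P) ↔ μ S ≤ (A : ℝ≥0∞) / PM := by
  have h : Feasible μ ν A (onOff S P) ↔ ∫⁻ ω, power ν (onOff S P ω) ∂μ ≤ A :=
    ⟨fun h => h.avg_le, fun h => ⟨measurable_uncurry_onOff hS hP.measurable, h⟩⟩
  rw [h, lintegral_power_onOff hS, hP.power_eq, mul_comm,
    ENNReal.le_div_iff_mul_le (Or.inl (ENNReal.coe_ne_zero.2 hPM.ne')) (Or.inl (by finiteness))]

theorem outage_le_worstOutage {T U : Ω → Allocation} (hU : Feasible μ ν B U) :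
    outage μ ν N R T U ≤ worstOutage μ ν N R B T :=
  le_iSup₂_of_le U hU le_rfl

/-- A jammer who can bound the jamming costs on `G` by a function of integral less than `B` causes
an outage on almost all of `G`, besides the silent frames. -/
theorem measure_union_le_worstOutage [IsProbabilityMeasure μ] [IsProbabilityMeasure ν]
    (hν : ∀ᵐ h ∂ν, 0 ≤ h) (hN : 0 < N) (hR : 0 < R) {T : Ω → Allocation}
    (hT : Measurable (Function.uncurry T)) {Z G : Set Ω} (hZ : ∀ ω ∈ Z, T ω = 0)
    (hG : MeasurableSet G) {f : Ω → ℝ≥0∞} (hf : Measurable f)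
    (hcost : ∀ ω ∈ G, jamCost ν N R (T ω) ≤ f ω) (hB : ∫⁻ ω in G, f ω ∂μ < B) :
    μ (Z ∪ G) ≤ worstOutage μ ν N R B T := by
  -- the slack `ε` of the budget pays for exceeding the jamming costs slightly
  obtain ⟨ε, hε, hεB⟩ := ENNReal.lt_iff_exists_add_pos_lt.1 hB
  have hm : MeasurableSet (G ∩ {ω | f ω < ∞}) :=
    hG.inter (measurableSet_lt hf measurable_const)
  obtain ⟨U, hU, hUG⟩ := exists_feasible_capacity_lt (μ := μ) (B := B) hν hN hR hT hm
    (hf.add_const (ε : ℝ≥0∞))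
    (fun ω hω => (hcost ω hω.1).trans_lt
      (ENNReal.lt_add_right hω.2.ne (ENNReal.coe_ne_zero.2 hε.ne')))
    (by
      calc _ ≤ ∫⁻ ω in G, (f ω + ε) ∂μ := lintegral_mono_set inter_subset_left
        _ = ∫⁻ ω in G, f ω ∂μ + ε * μ G := by
          rw [lintegral_add_right _ measurable_const, setLIntegral_const]
        _ ≤ ∫⁻ ω in G, f ω ∂μ + ε * 1 := by
          gcongr
          exact prob_le_one
        _ ≤ B := by rw [mul_one]; exact hεB.le)
  refine le_trans ?_ (outage_le_worstOutage (N := N) (R := R) (T := T) hU)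
  have hnull : μ (G \ {ω | f ω < ∞}) = 0 := by
    have h : μ.restrict G {ω | f ω < ∞}ᶜ = 0 := ae_lt_top hf hB.ne_top
    rw [Measure.restrict_apply (measurableSet_lt hf measurable_const).compl] at h
    rwa [sdiff_eq, inter_comm]
  calc μ (Z ∪ G) ≤ μ ({ω | capacity ν N (T ω) (U ω) < ENNReal.ofReal R} ∪
        (G \ {ω | f ω < ∞})) := by
        refine measure_mono ?_
        rintro ω (hω | hω)
        · left
          change capacity ν N (T ω) (U ω) < _
          rw [hZ ω hω, capacity_zero_left]
          exact ENNReal.ofReal_pos.2 hR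
        · by_cases h : f ω < ∞
          · exact Or.inl (hUG ω ⟨hω, h⟩)
          · exact Or.inr ⟨hω, h⟩
    _ ≤ _ := (measure_union_le _ _).trans_eq (by rw [hnull, add_zero]; rfl)

theorem worstOutage_onOff [StandardBorelSpace Ω] [IsProbabilityMeasure μ]
    [NullSingletonClass μ] [IsProbabilityMeasure ν] (hν : ∀ᵐ h ∂ν, 0 ≤ h) (hN : 0 < N)
    (hR : 0 < R) (hB : 0 < B) {PM : ℝ≥0} {P : Allocation}
    (hP : IsOptimalAllocation ν N R PM P) {S : Set Ω} (hS : MeasurableSet S) :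
    worstOutage μ ν N R B (onOff S P) =
      1 - μ S + min (μ S) ((B : ℝ≥0∞) / requiredJam ν N R PM) := by
  have hB' : (B : ℝ≥0∞) ≠ 0 := ENNReal.coe_ne_zero.2 hB.ne'
  have hT := measurable_uncurry_onOff hS hP.measurable
  have hSc : μ Sᶜ = 1 - μ S := prob_compl_eq_one_sub hS
  refine le_antisymm (iSup₂_le fun U hU => ?_) ?_
  · have hO : MeasurableSet {ω | capacity ν N (onOff S P ω) (U ω) < ENNReal.ofReal R} :=
      measurableSet_lt (measurable_capacity hT hU.measurable) measurable_const
    set O := {ω | capacity ν N (onOff S P ω) (U ω) < ENNReal.ofReal R} with hOdef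
    have h1 : outage μ ν N R (onOff S P) U ≤ μ Sᶜ + μ (O ∩ S) := by
      refine (measure_mono fun ω hω => ?_).trans (measure_union_le _ _)
      by_cases h : ω ∈ S
      · exact Or.inr ⟨hω, h⟩
      · exact Or.inl h
    refine h1.trans ?_
    rw [hSc]
    gcongr
    refine le_min (measure_mono inter_subset_right) ?_
    rw [ENNReal.le_div_iff_mul_le (Or.inr hB') (Or.inr (by finiteness)), mul_comm,
      ← setLIntegral_const]
    calc _ ≤ ∫⁻ ω in O ∩ S, power ν (U ω) ∂μ := by
          refine setLIntegral_mono' (hO.inter hS) fun ω hω => ?_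
          have h2 : capacity ν N (onOff S P ω) (U ω) < ENNReal.ofReal R := hω.1
          rw [onOff_of_mem hω.2] at h2
          rw [← hP.jamCost_eq]
          exact jamCost_le hU.measurable.of_uncurry_left h2.le
      _ ≤ ∫⁻ ω, power ν (U ω) ∂μ := setLIntegral_le_lintegral _ _
      _ ≤ B := hU.avg_le
  · have key : ∀ s : ℝ≥0∞, s ≤ μ S → requiredJam ν N R PM * s < B →
        1 - μ S + s ≤ worstOutage μ ν N R B (onOff S P) := by
      intro s hs hsB
      obtain ⟨G, hGS, hG, rfl⟩ := exists_measurableSet_subset_measure_eq hS hs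
      rw [← hSc, ← measure_union (disjoint_compl_left.mono_right hGS) hG]
      refine measure_union_le_worstOutage (f := fun _ => requiredJam ν N R PM) hν hN hR hT
        (fun ω hω => onOff_of_notMem hω P) hG measurable_const (fun ω hω => ?_) ?_
      · rw [onOff_of_mem (hGS hω), hP.jamCost_eq]
      · rwa [setLIntegral_const]
    have h0 : 1 - μ S ≤ worstOutage μ ν N R B (onOff S P) := by
      simpa using key 0 zero_le (by simpa using hB)
    refine add_le_of_le_tsub_left_of_le h0 (le_of_forall_lt_imp_le_of_dense fun s hs => ?_)
    refine ENNReal.le_sub_of_add_le_left (by finiteness) (key s (hs.trans_le (min_le_left _ _)).le ?_)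
    rw [mul_comm]
    exact ENNReal.mul_lt_of_lt_div (hs.trans_le (min_le_right _ _))

theorem one_sub_add_min_anti {s s' : ℝ≥0∞} (h : s ≤ s') (hs' : s' ≤ 1) (k : ℝ≥0∞) :
    1 - s' + min s' k ≤ 1 - s + min s k := by
  rcases le_total s k with hk | hk
  · rw [min_eq_left hk, tsub_add_cancel_of_le (h.trans hs')]
    calc _ ≤ 1 - s' + s' := by gcongr; exact min_le_left _ _
      _ = 1 := tsub_add_cancel_of_le hs'
  · rw [min_eq_right hk, min_eq_right (hk.trans h)]
    gcongr

theorem div_le_one_of_le_coe {PM : ℝ≥0} (h : A ≤ PM) : (A : ℝ≥0∞) / PM ≤ 1 :=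
  ENNReal.div_le_of_le_mul (by simpa using h)

theorem one_sub_add_min_eq_pOut {PM : ℝ≥0} (h : A ≤ PM) :
    1 - (A : ℝ≥0∞) / PM + min ((A : ℝ≥0∞) / PM) ((B : ℝ≥0∞) / requiredJam ν N R PM) =
      pOut ν N R A B PM := by
  rw [pOut, outageFormula, ← min_add_add_left, tsub_add_cancel_of_le (div_le_one_of_le_coe h)]

/-! ### The lower bound for arbitrary transmitter strategies -/

/-- The arithmetic of the lower bound: with common power `t` on a fraction `A / t` of the frames,
the jammer would reach an outage of `m`. -/
theorem lt_of_lt_outageFormula {t : ℝ≥0} (ht : 0 < t) (hAt : A ≤ t) (hB : 0 < B)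
    {m a I : ℝ≥0∞} (hm1 : m < 1) (hm : m < outageFormula ν N R A B t)
    (ha : a + t * (1 - m) ≤ A) (hI : I * t ≤ requiredJam ν N R t * a) : I < B := by
  unfold outageFormula at hm
  generalize requiredJam ν N R t = V at *
  by_contra! hBI
  have haA : a ≤ A := le_self_add.trans ha
  lift a to ℝ≥0 using ne_top_of_le_ne_top (by finiteness) haA
  lift m to ℝ≥0 using hm1.ne_top
  have hm1' : m < 1 := by exact_mod_cast hm1
  have e1 : (1 : ℝ≥0∞) - m = ((1 - m : ℝ≥0) : ℝ≥0∞) := by simp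
  rw [e1] at ha
  have ha' : a + t * (1 - m) ≤ A := by exact_mod_cast ha
  have e2 : (1 : ℝ≥0∞) - A / t = ((1 - A / t : ℝ≥0) : ℝ≥0∞) := by
    rw [ENNReal.coe_sub, ENNReal.coe_div ht.ne', ENNReal.coe_one]
  rw [e2] at hm
  have hAt1 : A / t ≤ 1 := div_le_one_of_le₀ hAt zero_le
  have hBt : (B : ℝ≥0∞) * t ≤ V * a := le_trans (by gcongr) hI
  rcases eq_or_ne V ∞ with rfl | hV
  · rw [ENNReal.div_top, add_zero] at hm
    have hm' : m < 1 - A / t := by exact_mod_cast hm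
    rw [← NNReal.coe_lt_coe, NNReal.coe_sub hAt1] at hm'
    rw [← NNReal.coe_le_coe] at ha'
    push_cast [NNReal.coe_sub hm1'.le] at ha' hm'
    have ht' : (0 : ℝ) < t := ht
    have h3 : (A : ℝ) / t * t = A := by field_simp
    have := a.2
    nlinarith
  · lift V to ℝ≥0 using hV
    have hBt' : B * t ≤ V * a := by exact_mod_cast hBt
    have hV0 : V ≠ 0 := by
      rintro rfl
      rw [zero_mul] at hBt'
      exact (mul_pos hB ht).not_ge hBt'
    rw [← ENNReal.coe_div hV0] at hm
    have hm' : m < (1 - A / t) + B / V := by exact_mod_cast hm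
    rw [← NNReal.coe_lt_coe, NNReal.coe_add, NNReal.coe_sub hAt1] at hm'
    rw [← NNReal.coe_le_coe] at ha' hBt'
    push_cast [NNReal.coe_sub hm1'.le] at ha' hm' hBt'
    have ht' : (0 : ℝ) < t := ht
    have hV' : (0 : ℝ) < V := NNReal.coe_pos.2 (pos_iff_ne_zero.2 hV0)
    have h3 : (B : ℝ) / V ≤ a / t := by
      rw [div_le_div_iff₀ hV' ht']
      linarith
    have h4 : (a : ℝ) / t ≤ A / t - (1 - m) := by
      rw [div_le_iff₀ ht', sub_mul, div_mul_cancel₀ _ ht'.ne']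
      linarith
    linarith

/-- No admissible transmitter strategy beats the best common power level.  Given `m` below all
values of `pOut`, the jammer attacks the fraction `m` of the frames that carry the least power; by
monotonicity of `V x / x`, the cost is below the budget, or else a common power level would
already give an outage of at most `m`. -/
theorem iInf_pOut_le_worstOutage [StandardBorelSpace Ω] [IsProbabilityMeasure μ]
    [NullSingletonClass μ] [IsProbabilityMeasure ν] (hν : ∀ᵐ h ∂ν, 0 ≤ h) (hN : 0 < N)
    (hR : 0 < R) (hA : 0 < A) (hB : 0 < B) {T : Ω → Allocation} (hT : Feasible μ ν A T) :
    ⨅ (q : ℝ≥0) (_ : A ≤ q), pOut ν N R A B q ≤ worstOutage μ ν N R B T := by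
  refine le_of_forall_lt_imp_le_of_dense fun m hm => ?_
  have hmq : ∀ q, A ≤ q → m < pOut ν N R A B q := fun q hq => hm.trans_le (iInf₂_le q hq)
  have hm1 : m < 1 := (hmq A le_rfl).trans_le (min_le_left _ _)
  have hpm : Measurable fun ω => power ν (T ω) := measurable_power hT.measurable
  have hpfin : ∀ᵐ ω ∂μ, power ν (T ω) < ∞ :=
    ae_lt_top hpm (hT.avg_le.trans_lt (by finiteness)).ne
  set x : Ω → ℝ≥0 := fun ω => (power ν (T ω)).toNNReal
  have hx : Measurable x := hpm.ennreal_toNNReal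
  have hxA : ∫⁻ ω, (x ω : ℝ≥0∞) ∂μ ≤ A := by
    refine le_trans (lintegral_mono fun ω => ?_) hT.avg_le
    exact ENNReal.coe_toNNReal_le_self
  obtain ⟨G, t, hG, hGm, hGt, hGt'⟩ := exists_measurableSet_measure_eq_le_threshold (μ := μ) hx hm1
  have hVm : Measurable fun ω => requiredJam ν N R (x ω) :=
    requiredJam_mono.measurable.comp hx
  have hcost : ∫⁻ ω in G, requiredJam ν N R (x ω) ∂μ < B := by
    rcases lt_or_ge t A with htA | htA
    -- all attacked frames carry less power than `A`: compare with the common power `A`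
    · have h1 := (hmq A le_rfl).trans_le (min_le_right _ _)
      rw [outageFormula, ENNReal.div_self (ENNReal.coe_ne_zero.2 hA.ne') (by finiteness),
        tsub_self, zero_add] at h1
      refine lt_of_le_of_lt ?_ (ENNReal.mul_lt_of_lt_div h1)
      calc _ ≤ ∫⁻ _ in G, requiredJam ν N R A ∂μ :=
            setLIntegral_mono' hG fun ω hω => requiredJam_mono ((hGt ω hω).trans htA.le)
        _ = m * requiredJam ν N R A := by rw [setLIntegral_const, hGm, mul_comm]
    -- otherwise compare with the common power `t`
    · refine lt_of_lt_outageFormula (a := ∫⁻ ω in G, (x ω : ℝ≥0∞) ∂μ) (hA.trans_le htA) htA hB hm1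
        ((hmq t htA).trans_le (min_le_right _ _)) ?_ ?_
      · rw [← lintegral_add_compl (fun ω => (x ω : ℝ≥0∞)) hG] at hxA
        refine (add_le_add_right ?_ _).trans hxA
        rw [← hGm, ← prob_compl_eq_one_sub hG, ← setLIntegral_const]
        exact setLIntegral_mono' hG.compl fun ω hω => ENNReal.coe_le_coe.2 (hGt' ω hω)
      · rw [← lintegral_mul_const _ hVm, ← lintegral_const_mul _ hx.coe_nnreal_ennreal]
        exact setLIntegral_mono' hG fun ω hω => requiredJam_mul_le hν hN (hGt ω hω)
  have hm' : MeasurableSet (G ∩ {ω | power ν (T ω) < ∞}) :=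
    hG.inter (measurableSet_lt hpm measurable_const)
  have h := measure_union_le_worstOutage (μ := μ) (B := B) (Z := ∅) hν hN hR hT.measurable
    (by simp) hm' hVm (fun ω hω => jamCost_le_requiredJam hT.measurable.of_uncurry_left
      (ENNReal.coe_toNNReal hω.2.ne).ge) ((lintegral_mono_set inter_subset_left).trans_lt hcost)
  rw [empty_union, measure_inter_conull hpfin, hGm] at h
  exact h

/-! ### Minimizing over the common power level -/

theorem lowerSemicontinuousAt_pOut [IsProbabilityMeasure ν] (hν : ∀ᵐ h ∂ν, 0 ≤ h) (hN : 0 < N)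
    (hR : 0 < R) {q : ℝ≥0} (hq : 0 < q) : LowerSemicontinuousAt (pOut ν N R A B) q := by
  have hV : UpperSemicontinuousAt (requiredJam ν N R) q := by
    intro y hy
    have : ∃ q', q < q' ∧ requiredJam ν N R q' < y := by
      by_contra! hc
      exact (le_requiredJam_of_forall_gt hν hN hR hq hc).not_gt hy
    obtain ⟨q', hq', hy'⟩ := this
    filter_upwards [gt_mem_nhds hq'] with p hp
    exact (requiredJam_mono hp.le).trans_lt hy'
  have h1 : LowerSemicontinuousAt (fun p : ℝ≥0 => 1 - (A : ℝ≥0∞) / p) q := by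
    refine ContinuousAt.lowerSemicontinuousAt ?_
    refine ENNReal.Tendsto.sub tendsto_const_nhds ?_ (Or.inl ENNReal.one_ne_top)
    refine ENNReal.Tendsto.div tendsto_const_nhds (Or.inr (ENNReal.coe_ne_zero.2 hq.ne'))
      (ENNReal.tendsto_coe.2 tendsto_id) (Or.inl (by finiteness))
  have h2 : LowerSemicontinuousAt (fun p : ℝ≥0 => (B : ℝ≥0∞) / requiredJam ν N R p) q := by
    refine ContinuousAt.comp_upperSemicontinuousAt_antitone
      (g := fun w : ℝ≥0∞ => (B : ℝ≥0∞) / w) ?_ hV fun a b hab => ENNReal.div_le_div_left hab _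
    exact (ENNReal.continuous_const_mul (by finiteness)).comp continuous_inv |>.continuousAt
  exact (continuous_const.min continuous_id).continuousAt.comp_lowerSemicontinuousAt
    (f := outageFormula ν N R A B) (h1.add h2) fun a b hab => min_le_min_left 1 hab

theorem exists_isMinOn_pOut [IsProbabilityMeasure ν] (hν : ∀ᵐ h ∂ν, 0 ≤ h) (hN : 0 < N)
    (hR : 0 < R) (hA : 0 < A) : ∃ q : ℝ≥0, A ≤ q ∧ IsMinOn (pOut ν N R A B) (Ici A) q := by
  by_cases h : ∃ q₀, A ≤ q₀ ∧ pOut ν N R A B q₀ < 1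
  swap
  · push Not at h
    exact ⟨A, le_rfl, fun q hq => (min_le_left _ _).trans (h q hq)⟩
  obtain ⟨q₀, hq₀, hlt⟩ := h
  -- beyond the power level `n`, the frames without transmission alone exceed `pOut q₀`
  obtain ⟨n, hn⟩ := ENNReal.exists_nat_mul_gt (tsub_pos_of_lt hlt).ne' (ENNReal.coe_ne_top (r := A))
  obtain ⟨q, hq, hmin⟩ := LowerSemicontinuousOn.exists_isMinOn
    (s := Icc A (max q₀ n)) (f := pOut ν N R A B) ⟨q₀, hq₀, le_max_left _ _⟩ isCompact_Icc
    fun p hp => (lowerSemicontinuousAt_pOut hν hN hR (hA.trans_le hp.1)).lowerSemicontinuousWithinAt _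
  refine ⟨q, hq.1, fun p hp => ?_⟩
  rcases le_or_gt p (max q₀ n) with h | h
  · exact hmin ⟨hp, h⟩
  · refine (hmin ⟨hq₀, le_max_left _ _⟩).out.trans (le_min hlt.le (le_trans ?_ le_self_add))
    refine ENNReal.le_sub_of_add_le_right ((div_le_one_of_le_coe hp).trans_lt ENNReal.one_lt_top).ne ?_
    have h2 : (A : ℝ≥0∞) / p ≤ 1 - pOut ν N R A B q₀ := by
      refine ENNReal.div_le_of_le_mul (hn.le.trans ?_)
      rw [mul_comm]
      gcongr
      exact_mod_cast (le_max_right q₀ (n : ℝ≥0)).trans h.le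
    exact (add_le_add_right h2 _).trans_eq (add_tsub_cancel_of_le hlt.le)

theorem iInf_outageFormula_le_one [IsProbabilityMeasure ν] (hν : ∀ᵐ h ∂ν, 0 < h) (hN : 0 < N) :
    ⨅ (q : ℝ≥0) (_ : A ≤ q), outageFormula ν N R A B q ≤ 1 := by
  refine ENNReal.le_of_forall_pos_le_add fun ε hε _ => ?_
  obtain ⟨q₀, hq₀⟩ := exists_le_requiredJam (R := R) hν hN (B / ε)
  refine (iInf₂_le (max A q₀) (le_max_left _ _)).trans ?_
  unfold outageFormula
  gcongr
  · exact tsub_le_self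
  · have h := hq₀ _ (le_max_right A q₀)
    rw [ENNReal.coe_div hε.ne'] at h
    refine ENNReal.div_le_of_le_mul ?_
    rw [mul_comm]
    exact (ENNReal.div_le_iff_le_mul (Or.inl (ENNReal.coe_ne_zero.2 hε.ne'))
      (Or.inl (by finiteness))).1 h

end

end Jamming

theorem mainTheorem9
    {Ω : Type*} [MeasurableSpace Ω] [StandardBorelSpace Ω]
    (μ : Measure Ω) [IsProbabilityMeasure μ] [NullSingletonClass μ]
    (ν : Measure ℝ) [IsProbabilityMeasure ν] (hν : ν ≪ volume) (hν0 : ν (Set.Iio 0) = 0)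
    (N R : ℝ) (hN : 0 < N) (hR : 0 < R)
    (A B : ℝ≥0) (hA : 0 < A) (hB : 0 < B) :
    -- a minimizing power level exists
    (∃ PM : ℝ≥0, A ≤ PM ∧ IsMinOn (Jamming.pOut ν N R A B) (Set.Ici A) PM) ∧
    -- every power level `PM ≥ A` has an optimal allocation and a set of frames of measure `A / PM`
    (∀ PM : ℝ≥0, A ≤ PM →
      (∃ P : Jamming.Allocation, Jamming.IsOptimalAllocation ν N R PM P) ∧
      (∃ S : Set Ω, MeasurableSet S ∧ μ S = (A : ℝ≥0∞) / PM)) ∧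
    -- with a common power `PM`, `A / PM` is the largest admissible fraction of frames,
    -- the worst-case outage is explicit, and more frames are never worse
    (∀ (PM : ℝ≥0) (P : Jamming.Allocation), 0 < PM → Jamming.IsOptimalAllocation ν N R PM P →
      (∀ S : Set Ω, MeasurableSet S →
        (Jamming.Feasible μ ν A (Jamming.onOff S P) ↔ μ S ≤ (A : ℝ≥0∞) / PM) ∧
        Jamming.worstOutage μ ν N R B (Jamming.onOff S P) =
          1 - μ S + min (μ S) ((B : ℝ≥0∞) / Jamming.requiredJam ν N R PM)) ∧
      (∀ S S' : Set Ω, MeasurableSet S → MeasurableSet S' → μ S ≤ μ S' →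
        Jamming.worstOutage μ ν N R B (Jamming.onOff S' P) ≤
          Jamming.worstOutage μ ν N R B (Jamming.onOff S P))) ∧
    -- with `PM ≥ A` on a maximal set of frames, the worst-case outage is `pOut`; if `PM`
    -- minimizes `pOut`, the strategy is optimal among all transmitter strategies
    (∀ (PM : ℝ≥0) (P : Jamming.Allocation) (S : Set Ω), A ≤ PM →
      Jamming.IsOptimalAllocation ν N R PM P → MeasurableSet S → μ S = (A : ℝ≥0∞) / PM →
      Jamming.worstOutage μ ν N R B (Jamming.onOff S P) = Jamming.pOut ν N R A B PM ∧
      (IsMinOn (Jamming.pOut ν N R A B) (Set.Ici A) PM →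
        Jamming.IsMinimaxOptimal μ ν N R A B (Jamming.onOff S P))) ∧
    -- the minimax value
    (⨅ (T : Ω → Jamming.Allocation) (_ : Jamming.Feasible μ ν A T),
        Jamming.worstOutage μ ν N R B T) =
      ⨅ (PM : ℝ≥0) (_ : A ≤ PM), Jamming.outageFormula ν N R A B PM := by
  have hν0' : ∀ᵐ h ∂ν, 0 ≤ h := by
    have hset : {h : ℝ | ¬0 ≤ h} = Set.Iio 0 := by ext; simp
    rw [ae_iff, hset]
    exact hν0
  have hpos : ∀ᵐ h ∂ν, 0 < h := by
    have hne : ∀ᵐ h ∂ν, h ≠ 0 := hν.ae_le (Measure.ae_ne volume 0)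
    filter_upwards [hν0', hne] with h h1 h2 using h1.lt_of_ne h2.symm
  have hwin : ∀ (PM : ℝ≥0) (P : Jamming.Allocation) (S : Set Ω), A ≤ PM →
      Jamming.IsOptimalAllocation ν N R PM P → MeasurableSet S → μ S = (A : ℝ≥0∞) / PM →
      Jamming.worstOutage μ ν N R B (Jamming.onOff S P) = Jamming.pOut ν N R A B PM := by
    intro PM P S hPM hP hS hμS
    rw [Jamming.worstOutage_onOff hν0' hN hR hB hP hS, hμS, Jamming.one_sub_add_min_eq_pOut hPM]
  have hfeas : ∀ (PM : ℝ≥0) (P : Jamming.Allocation) (S : Set Ω), A ≤ PM →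
      Jamming.IsOptimalAllocation ν N R PM P → MeasurableSet S → μ S = (A : ℝ≥0∞) / PM →
      Jamming.Feasible μ ν A (Jamming.onOff S P) := fun PM P S hPM hP hS hμS =>
    (Jamming.feasible_onOff_iff hS (hA.trans_le hPM) hP).2 hμS.le
  have hset : ∀ PM : ℝ≥0, A ≤ PM → ∃ S : Set Ω, MeasurableSet S ∧ μ S = (A : ℝ≥0∞) / PM := by
    intro PM hPM
    obtain ⟨S, -, hS, hμS⟩ := Jamming.exists_measurableSet_subset_measure_eq (μ := μ)
      MeasurableSet.univ ((Jamming.div_le_one_of_le_coe hPM).trans_eq measure_univ.symm)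
    exact ⟨S, hS, hμS⟩
  refine ⟨Jamming.exists_isMinOn_pOut hν0' hN hR hA, fun PM hPM =>
    ⟨Jamming.exists_isOptimalAllocation hν0' hN hR (hA.trans_le hPM), hset PM hPM⟩,
    fun PM P hPM hP => ⟨fun S hS => ⟨Jamming.feasible_onOff_iff hS hPM hP,
      Jamming.worstOutage_onOff hν0' hN hR hB hP hS⟩, fun S S' hS hS' hSS' => ?_⟩,
    fun PM P S hPM hP hS hμS => ⟨hwin PM P S hPM hP hS hμS, fun hmin =>
      ⟨hfeas PM P S hPM hP hS hμS, fun T' hT' => ?_⟩⟩, le_antisymm ?_ ?_⟩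
  · rw [Jamming.worstOutage_onOff hν0' hN hR hB hP hS,
      Jamming.worstOutage_onOff hν0' hN hR hB hP hS']
    exact Jamming.one_sub_add_min_anti hSS' prob_le_one _
  · rw [hwin PM P S hPM hP hS hμS]
    exact (le_iInf₂ fun q hq => hmin hq).trans
      (Jamming.iInf_pOut_le_worstOutage hν0' hN hR hA hB hT')
  · refine le_iInf₂ fun PM hPM => ?_
    obtain ⟨P, hP⟩ := Jamming.exists_isOptimalAllocation hν0' hN hR (hA.trans_le hPM)
    obtain ⟨S, hS, hμS⟩ := hset PM hPM
    refine (iInf₂_le _ (hfeas PM P S hPM hP hS hμS)).trans ?_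
    rw [hwin PM P S hPM hP hS hμS]
    exact min_le_right _ _
  · refine le_iInf₂ fun T hT => le_trans ?_
      (Jamming.iInf_pOut_le_worstOutage hν0' hN hR hA hB hT)
    -- the cap at one is harmless, since the infimum of the uncapped expression is at most one
    exact le_iInf₂ fun q hq => le_min (Jamming.iInf_outageFormula_le_one hpos hN) (iInf₂_le q hq)
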